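/- All Hilbert spaces are complex and separable, and the zero space is allowed. Let $n>1$ and $I_n=\{1,\dots,n\}$. A *$\mathcal U_n$-twisted isometry* is an $n$-tuple $V=(V_1,\dots,V_n)$ of isometries on a Hilbert space $\mathcal H$ for which there are commuting unitaries $U_{ij}$ $(i\neq j)$ on $\mathcal H$ with $U_{ji}=U_{ij}^*$, $V_i^*V_j=U_{ij}^*V_jV_i^*$ and $V_kU_{ij}=U_{ij}V_k$ for all $i,j,k\in I_n$, $i\ne j$. (The $U_{ij}=V_i^*V_j^*V_iV_j$ are determined by $V$.) Two such tuples, $V$ on $\mathcal H$ and $V'$ on $\mathcal H'$, are unitarily equivalent if there is a unitary $\Psi:\mathcal H\to\mathcal H'$ with $\Psi V_i=V_i'\Psi$ for all $i$. For $A\subseteq I_n$, the *twisted noncommutative torus* $\mathbb T_A$ is the universal unital $C^*$-algebra generated by unitaries $g_i$ $(i\in I_n\setminus A)$ and $u_{jk}$ $(j\neq k$ in $I_n)$ subject to $u_{kj}=u_{jk}^*$, $g_iu_{jk}=u_{jk}g_i$, $g_{i_1}g_{i_2}=u_{i_1i_2}g_{i_2}g_{i_1}$ $(i_1\ne i_2)$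 and $u_{jk}u_{lm}=u_{lm}u_{jk}$. A unital representation of $\mathbb T_A$ is a unital $*$-homomorphism $\pi:\mathbb T_A\to\mathcal B(\mathcal K)$ with $\mathcal K$ a Hilbert space; $\pi$ and $\pi':\mathbb T_A\to\mathcal B(\mathcal K')$ are unitarily equivalent if there is a unitary $\Psi:\mathcal K\to\mathcal K'$ with $\Psi\pi(a)=\pi'(a)\Psi$ for all $a\in\mathbb T_A$. For a $\mathcal U_n$-twisted isometry $V$ and $A\subseteq I_n$ with $I_n\setminus A=\{q_1<\dots<q_r\}$, let $$\mathcal D_A(V)=\bigcap_{l\in\mathbb Z_+^{r}}V_{q_1}^{l_1}\cdots V_{q_r}^{l_r}\Big(\bigcap_{i\in A}\ker V_i^*\Big),$$ where the intersection over $i\in\emptyset$ is $\mathcal H$ and, if $r=0$, $\mathcal D_A(V)=\bigcap_{i\in A}\ker V_i^*$. **Theorem.** For every $\mathcal U_n$-twisted isometry $V$ and every $A\subseteq I_n$ there is a unital representation $\pi_V(A)$ of $\mathbb T_A$ on $\mathcal D_A(V)$ with $\pi_V(A)(g_i)=V_i|_{\mathcal D_A(V)}$ $(i\in I_n\setminus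 A)$ and $\pi_V(A)(u_{jk})=U_{jk}|_{\mathcal D_A(V)}$ $(j\ne k)$. The assignment $[V]\mapsto\big([\pi_V(A)]\big)_{A\subseteq I_n}$ is a well-defined bijection from the set of unitary equivalence classes of $\mathcal U_n$-twisted isometries onto the set of families, indexed by the $2^n$ subsets $A\subseteq I_n$, of unitary equivalence classes of unital representations of $\mathbb T_A$. -/

import Mathlib

open scoped ENNReal

universe u v

/-! ### Twisted isometries

All Hilbert spaces are complex, complete and separable; the zero space is allowed. -/

/-- A `𝒰_n`-twisted isometry: isometries `V_1, …, V_n` on a separable Hilbert space `H`, together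
with the (commuting) unitaries `U_{ij}`, `i ≠ j`, with respect to which they are twisted. -/
structure TwistedIsometry (n : ℕ) : Type (u + 1) where
  H : Type u
  [normedAddCommGroup : NormedAddCommGroup H]
  [innerProductSpace : InnerProductSpace ℂ H]
  [completeSpace : CompleteSpace H]
  [separableSpace : TopologicalSpace.SeparableSpace H]
  V : Fin n → H →L[ℂ] H
  U : ∀ i j : Fin n, i ≠ j → H →L[ℂ] H
  isometry : ∀ i, star (V i) * V i = 1
  U_unitary : ∀ i j h, U i j h ∈ unitary (H →L[ℂ] H)
  U_swap : ∀ i j (h : i ≠ j), U j i h.symm = star (U i j h)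
  U_commute : ∀ i j h k l h', Commute (U i j h) (U k l h')
  twist : ∀ i j (h : i ≠ j), star (V i) * V j = star (U i j h) * V j * star (V i)
  V_commute_U : ∀ k i j h, Commute (V k) (U i j h)

namespace TwistedIsometry

attribute [instance] normedAddCommGroup innerProductSpace completeSpace separableSpace

variable {n : ℕ}

/-- Unitary equivalence of the `n`-tuples `(V_1, …, V_n)`. -/
instance setoid (n : ℕ) : Setoid (TwistedIsometry.{u} n) where
  r S T := ∃ Ψ : S.H ≃ₗᵢ[ℂ] T.H, ∀ i x, Ψ (S.V i x) = T.V i (Ψ x)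
  iseqv :=
    { refl := fun S => ⟨LinearIsometryEquiv.refl ℂ S.H, fun _ _ => rfl⟩
      symm := by
        rintro S T ⟨Ψ, h⟩
        exact ⟨Ψ.symm, fun i x => Ψ.injective (by simp [h])⟩
      trans := by
        rintro S T R ⟨Ψ, h⟩ ⟨Ψ', h'⟩
        exact ⟨Ψ.trans Ψ', fun i x => by simp [h, h']⟩ }

/-- `𝒲_A = ⋂_{i ∈ A} ker V_i^*`, with `𝒲_∅ = H`. -/
noncomputable def kerSubspace (S : TwistedIsometry.{u} n) (A : Finset (Fin n)) : Submodule ℂ S.H :=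
  ⨅ i ∈ A, LinearMap.ker (star (S.V i)).toLinearMap

/-- `V_{I_n ∖ A}^l = V_{q_1}^{l_{q_1}} ⋯ V_{q_r}^{l_{q_r}}`, where `q_1 < ⋯ < q_r` are the elements
of `I_n ∖ A`; the values of `l` on `A` are not used. -/
noncomputable def complMonomial (S : TwistedIsometry.{u} n) (A : Finset (Fin n)) (l : Fin n → ℕ) :
    S.H →L[ℂ] S.H :=
  ((Aᶜ.sort (· ≤ ·)).map fun q => S.V q ^ l q).prod

/-- The `A`-wandering subspace `𝒟_A(V) = ⋂_l V_{I_n ∖ A}^l 𝒲_A`. -/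
noncomputable def wanderingSubspace (S : TwistedIsometry.{u} n) (A : Finset (Fin n)) :
    Submodule ℂ S.H :=
  ⨅ l : Fin n → ℕ, (S.kerSubspace A).map (S.complMonomial A l).toLinearMap

theorem norm_V (S : TwistedIsometry.{u} n) (i : Fin n) (x : S.H) : ‖S.V i x‖ = ‖x‖ := by
  have h : ContinuousLinearMap.adjoint (S.V i) ∘L S.V i = 1 := S.isometry i
  exact (ContinuousLinearMap.norm_map_iff_adjoint_comp_self (S.V i)).2 h x

theorem norm_complMonomial (S : TwistedIsometry.{u} n) (A : Finset (Fin n)) (l : Fin n → ℕ)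
    (x : S.H) : ‖S.complMonomial A l x‖ = ‖x‖ := by
  have hpow : ∀ (q : Fin n) (m : ℕ) (y : S.H), ‖(S.V q ^ m) y‖ = ‖y‖ := by
    intro q m
    induction m with
    | zero => intro y; simp
    | succ m ih => intro y; rw [pow_succ, mul_apply_eq_comp, ih, S.norm_V]
  unfold complMonomial
  induction Aᶜ.sort (· ≤ ·) with
  | nil => simp
  | cons q L ih =>
    rw [List.map_cons, List.prod_cons, mul_apply_eq_comp, hpow, ih]

theorem isClosed_kerSubspace (S : TwistedIsometry.{u} n) (A : Finset (Fin n)) :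
    IsClosed (S.kerSubspace A : Set S.H) := by
  simp only [kerSubspace, Submodule.coe_iInf]
  exact isClosed_iInter fun i => isClosed_iInter fun _ => (star (S.V i)).isClosed_ker

theorem isClosed_wanderingSubspace (S : TwistedIsometry.{u} n) (A : Finset (Fin n)) :
    IsClosed (S.wanderingSubspace A : Set S.H) := by
  simp only [wanderingSubspace, Submodule.coe_iInf, Submodule.map_coe]
  refine isClosed_iInter fun l => ?_
  have h : Isometry (S.complMonomial A l) :=
    AddMonoidHomClass.isometry_of_norm _ (S.norm_complMonomial A l)
  exact h.isClosedEmbedding.isClosedMap _ (S.isClosed_kerSubspace A)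

instance (S : TwistedIsometry.{u} n) (A : Finset (Fin n)) :
    CompleteSpace (S.wanderingSubspace A) :=
  (S.isClosed_wanderingSubspace A).completeSpace_coe

end TwistedIsometry

/-! ### Twisted noncommutative tori -/

/-- Unitaries `g_i` (`i ∈ I_n ∖ A`) and `u_{jk}` (`j ≠ k` in `I_n`) in a unital C⋆-algebra `B` that
satisfy the defining relations of the twisted noncommutative torus with respect to `A`. -/
structure TorusTuple {n : ℕ} (A : Finset (Fin n)) (B : Type v) [CStarAlgebra B] where
  g : ∀ i : Fin n, i ∉ A → B
  u : ∀ j k : Fin n, j ≠ k → B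
  g_unitary : ∀ i h, g i h ∈ unitary B
  u_unitary : ∀ j k h, u j k h ∈ unitary B
  u_swap : ∀ j k (h : j ≠ k), u k j h.symm = star (u j k h)
  g_commute_u : ∀ i hi j k h, Commute (g i hi) (u j k h)
  g_twist : ∀ i₁ i₂ h₁ h₂ (h : i₁ ≠ i₂), g i₁ h₁ * g i₂ h₂ = u i₁ i₂ h * g i₂ h₂ * g i₁ h₁
  u_commute : ∀ j k h l m h', Commute (u j k h) (u l m h')

/-- All tuples satisfying the relations, in all non-zero unital C⋆-algebras (of universe `u`). -/
structure TorusModel {n : ℕ} (A : Finset (Fin n)) : Type (u + 1) where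
  B : Type u
  [cstarAlgebra : CStarAlgebra B]
  [nontrivial : Nontrivial B]
  tuple : TorusTuple A B

attribute [instance] TorusModel.cstarAlgebra TorusModel.nontrivial

section Torus

variable {n : ℕ} (A : Finset (Fin n))

/-- The C⋆-algebra of all bounded families indexed by `TorusModel A` (the `ℓ^∞`-product). -/
abbrev TorusProduct : Type (u + 1) := lp (fun σ : TorusModel.{u} A => σ.B) ∞

noncomputable instance : CStarAlgebra (TorusProduct.{u} A) where
  __ := lp.inftyNormedRing
  __ := lp.inftyStarRing
  __ := (inferInstance : CompleteSpace (TorusProduct.{u} A))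
  __ := lp.inftyCStarRing
  __ := (lp.inftyNormedAlgebra : NormedAlgebra ℂ (TorusProduct.{u} A))
  __ := (inferInstance : StarModule ℂ (TorusProduct.{u} A))

variable {A} in
theorem memlp_of_unitary (f : ∀ σ : TorusModel.{u} A, σ.B) (hf : ∀ σ, f σ ∈ unitary σ.B) :
    Memℓp f ∞ :=
  memℓp_infty ⟨1, by rintro _ ⟨σ, rfl⟩; exact (CStarRing.norm_of_mem_unitary (hf σ)).le⟩

/-- The universal tuple: the family of all tuples satisfying the relations. -/
noncomputable def productTuple : TorusTuple A (TorusProduct.{u} A) where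
  g i h := ⟨fun σ => σ.tuple.g i h, memlp_of_unitary _ fun σ => σ.tuple.g_unitary i h⟩
  u j k h := ⟨fun σ => σ.tuple.u j k h, memlp_of_unitary _ fun σ => σ.tuple.u_unitary j k h⟩
  g_unitary i h := by
    rw [Unitary.mem_iff]
    exact ⟨lp.ext (funext fun σ => (Unitary.mem_iff.1 (σ.tuple.g_unitary i h)).1),
      lp.ext (funext fun σ => (Unitary.mem_iff.1 (σ.tuple.g_unitary i h)).2)⟩
  u_unitary j k h := by
    rw [Unitary.mem_iff]
    exact ⟨lp.ext (funext fun σ => (Unitary.mem_iff.1 (σ.tuple.u_unitary j k h)).1),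
      lp.ext (funext fun σ => (Unitary.mem_iff.1 (σ.tuple.u_unitary j k h)).2)⟩
  u_swap j k h := lp.ext (funext fun σ => σ.tuple.u_swap j k h)
  g_commute_u i hi j k h := lp.ext (funext fun σ => σ.tuple.g_commute_u i hi j k h)
  g_twist i₁ i₂ h₁ h₂ h := lp.ext (funext fun σ => σ.tuple.g_twist i₁ i₂ h₁ h₂ h)
  u_commute j k h l m h' := lp.ext (funext fun σ => σ.tuple.u_commute j k h l m h')

/-- The set of generators of the twisted noncommutative torus. -/
def torusGenerators : Set (TorusProduct.{u} A) :=
  {x | (∃ i h, x = (productTuple A).g i h) ∨ ∃ j k h, x = (productTuple A).u j k h}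

/-- The C⋆-subalgebra generated by the universal tuple. -/
noncomputable def torusSubalgebra : StarSubalgebra ℂ (TorusProduct.{u} A) :=
  (StarAlgebra.adjoin ℂ (torusGenerators.{u} A)).topologicalClosure

instance : IsClosed (torusSubalgebra.{u} A : Set (TorusProduct.{u} A)) :=
  StarSubalgebra.isClosed_topologicalClosure _

/-- The twisted noncommutative torus `𝕋_A`: the universal unital C⋆-algebra generated by elements
`g_i` (`i ∈ I_n ∖ A`) and `u_{jk}` (`j ≠ k`) subject to the relations in `TorusTuple`, realized as
the C⋆-algebra generated by the universal tuple. Its universal property is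
`TwistedTorus.existsUnique_hom`. -/
def TwistedTorus : Type (u + 1) := torusSubalgebra.{u} A

noncomputable instance : CStarAlgebra (TwistedTorus.{u} A) :=
  inferInstanceAs (CStarAlgebra (torusSubalgebra.{u} A))

namespace TwistedTorus

theorem generators_subset : torusGenerators.{u} A ⊆ (torusSubalgebra.{u} A : Set _) :=
  (StarAlgebra.subset_adjoin ℂ _).trans (StarSubalgebra.le_topologicalClosure _)

/-- The generators of `𝕋_A`. -/
noncomputable def gen : TorusTuple A (TwistedTorus.{u} A) where
  g i h := ⟨(productTuple A).g i h, generators_subset A (Or.inl ⟨i, h, rfl⟩)⟩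
  u j k h := ⟨(productTuple A).u j k h, generators_subset A (Or.inr ⟨j, k, h, rfl⟩)⟩
  g_unitary i h := by
    have := Unitary.mem_iff.1 ((productTuple.{u} A).g_unitary i h)
    exact Unitary.mem_iff.2 ⟨Subtype.ext this.1, Subtype.ext this.2⟩
  u_unitary j k h := by
    have := Unitary.mem_iff.1 ((productTuple.{u} A).u_unitary j k h)
    exact Unitary.mem_iff.2 ⟨Subtype.ext this.1, Subtype.ext this.2⟩
  u_swap j k h := Subtype.ext ((productTuple A).u_swap j k h)
  g_commute_u i hi j k h := Subtype.ext ((productTuple A).g_commute_u i hi j k h)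
  g_twist i₁ i₂ h₁ h₂ h := Subtype.ext ((productTuple A).g_twist i₁ i₂ h₁ h₂ h)
  u_commute j k h l m h' := Subtype.ext ((productTuple A).u_commute j k h l m h')

variable {A}

open scoped CStarAlgebra in
/-- Unital ⋆-homomorphisms on `𝕋_A` are determined by their values on the generators. -/
theorem hom_ext {B : Type v} [CStarAlgebra B] {φ ψ : TwistedTorus.{u} A →⋆ₐ[ℂ] B}
    (hg : ∀ i h, φ ((gen A).g i h) = ψ ((gen A).g i h))
    (hu : ∀ j k h, φ ((gen A).u j k h) = ψ ((gen A).u j k h)) : φ = ψ := by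
  have hφ : Continuous φ := map_continuous φ
  have hψ : Continuous ψ := map_continuous ψ
  refine StarAlgHom.ext_topologicalClosure hφ hψ ?_
  refine StarAlgHom.ext_adjoin ?_
  rintro ⟨x, hx⟩ (⟨i, h, rfl⟩ | ⟨j, k, h, rfl⟩)
  · exact hg i h
  · exact hu j k h

/-- The universal property of `𝕋_A`. (A C⋆-algebra generated by a countable family has at most
continuum many elements, so it has a copy in every universe.) -/
theorem existsUnique_hom {B : Type u} [CStarAlgebra B] (t : TorusTuple A B) :
    ∃! φ : TwistedTorus.{u} A →⋆ₐ[ℂ] B,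
      (∀ i h, φ ((gen A).g i h) = t.g i h) ∧ ∀ j k h, φ ((gen A).u j k h) = t.u j k h := by
  refine existsUnique_of_exists_of_unique ?_ fun φ ψ hφ hψ =>
    hom_ext (fun i h => by rw [hφ.1, hψ.1]) (fun j k h => by rw [hφ.2, hψ.2])
  rcases subsingleton_or_nontrivial B with hB | hB
  · refine ⟨⟨⟨⟨⟨⟨fun _ => 0, ?_⟩, ?_⟩, ?_, ?_⟩, ?_⟩, ?_⟩, ?_, ?_⟩ <;> intros <;>
      exact Subsingleton.elim _ _
  · let σ : TorusModel.{u} A := ⟨B, t⟩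
    exact ⟨⟨⟨⟨⟨⟨fun x => x.1 σ, rfl⟩, fun _ _ => rfl⟩, rfl, fun _ _ => rfl⟩, fun _ => rfl⟩,
      fun _ => rfl⟩, fun _ _ => rfl, fun _ _ _ => rfl⟩

end TwistedTorus

end Torus

/-! ### Representations -/

/-- A unital representation of a unital C⋆-algebra on a separable Hilbert space. -/
structure UnitalRep (𝒜 : Type v) [CStarAlgebra 𝒜] : Type (max v (u + 1)) where
  H : Type u
  [normedAddCommGroup : NormedAddCommGroup H]
  [innerProductSpace : InnerProductSpace ℂ H]
  [completeSpace : CompleteSpace H]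
  [separableSpace : TopologicalSpace.SeparableSpace H]
  π : 𝒜 →⋆ₐ[ℂ] (H →L[ℂ] H)

namespace UnitalRep

attribute [instance] normedAddCommGroup innerProductSpace completeSpace separableSpace

/-- Unitary equivalence of representations. -/
instance setoid (𝒜 : Type v) [CStarAlgebra 𝒜] : Setoid (UnitalRep.{u} 𝒜) where
  r ρ τ := ∃ Ψ : ρ.H ≃ₗᵢ[ℂ] τ.H, ∀ a x, Ψ (ρ.π a x) = τ.π a (Ψ x)
  iseqv :=
    { refl := fun ρ => ⟨LinearIsometryEquiv.refl ℂ ρ.H, fun _ _ => rfl⟩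
      symm := by
        rintro ρ τ ⟨Ψ, h⟩
        exact ⟨Ψ.symm, fun a x => Ψ.injective (by simp [h])⟩
      trans := by
        rintro ρ τ κ ⟨Ψ, h⟩ ⟨Ψ', h'⟩
        exact ⟨Ψ.trans Ψ', fun a x => by simp [h, h']⟩ }

end UnitalRep

/-! A twisted isometry is a direct sum of weighted shifts whose weights are words in torus
generators. Since `V i` picks up opposite twists when it passes `V j` and `star (V j)`, it commutes
with every projection `V j ^ m * star (V j) ^ m`, `j ≠ i`. The Wold decompositions of the single
isometries are therefore compatible: the space is the orthogonal sum of joint components indexed by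
`κ : Fin n → ℕ∞`, and `V i` maps the component `κ` onto the component `κ + e_i`
(`component_add_single`, `eq_zero_of_inner_component`).

Let `A` be the set of coordinates where `κ` is finite. The component is then the translate `V^l 𝒟_A`
with `l` the finite part of `κ`, and `𝒟_A` itself is the component that is `0` on `A` and `⊤` off
`A` (`wanderingSubspace_eq_component`). There each `V i` with `i ∉ A` is onto, hence unitary, so
together with the twists it gives a tuple of torus generators, that is, a representation of `𝕋_A`.

Injectivity: moving `V i` through the ordered product `V^l` gives `V i (V^l x) = V^(l + e_i) (w x)`
for `i ∈ A` and `V i (V^l x) = V^l (w x)` for `i ∉ A`. The weight `w` is a word in the torus tuple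
on `𝒟_A` (`V_orderedMonomial`), so equivalences of all these tuples assemble into an equivalence of
the isometries (`equiv_of_torusTuple`).

Surjectivity: for arbitrary representations the same weights define shifts on the Hilbert sum of
copies of `K A`, one for each `l` supported in `A`. The relation `V_i V_j = U_ij V_j V_i` becomes a
cocycle identity for the weights (`weight_shift_mul_weight`), and the wandering subspaces are the
summands with `l = 0`.

The map is well defined because the twists are words in the `V i` and their adjoints (`twists_eq`).
-/

/-! ### Monomials in finitely many elements of a monoid -/

section Monomial

variable {ι M : Type*} [Monoid M]

/-- The ordered product `∏_{q ∈ L} f q ^ l q` along a list `L`. -/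
def listMonomial (f : ι → M) (l : ι → ℕ) (L : List ι) : M :=
  (L.map fun q => f q ^ l q).prod

@[simp] theorem listMonomial_nil (f : ι → M) (l : ι → ℕ) : listMonomial f l [] = 1 := rfl

@[simp] theorem listMonomial_cons (f : ι → M) (l : ι → ℕ) (a : ι) (L : List ι) :
    listMonomial f l (a :: L) = f a ^ l a * listMonomial f l L := by
  simp [listMonomial]

theorem listMonomial_congr {f g : ι → M} {l l' : ι → ℕ} {L : List ι}
    (h : ∀ q ∈ L, f q ^ l q = g q ^ l' q) : listMonomial f l L = listMonomial g l' L := by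
  unfold listMonomial
  rw [List.map_congr_left h]

theorem listMonomial_mem {P : Type*} [SetLike P M] [SubmonoidClass P M] (s : P) {f : ι → M}
    (h : ∀ q, f q ∈ s) (l : ι → ℕ) (L : List ι) : listMonomial f l L ∈ s := by
  induction L with
  | nil => exact one_mem s
  | cons a L ih => rw [listMonomial_cons]; exact mul_mem (pow_mem (h a) _) ih

theorem Commute.listMonomial_right {x : M} {f : ι → M} (h : ∀ q, Commute x (f q)) (l : ι → ℕ)
    (L : List ι) : Commute x (listMonomial f l L) := by
  induction L with
  | nil => exact Commute.one_right x
  | cons a L ih => rw [listMonomial_cons]; exact ((h a).pow_right _).mul_right ih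

theorem map_listMonomial {N F : Type*} [Monoid N] [FunLike F M N] [MonoidHomClass F M N] (φ : F)
    (f : ι → M) (l : ι → ℕ) (L : List ι) :
    φ (listMonomial f l L) = listMonomial (fun q => φ (f q)) l L := by
  induction L with
  | nil => simp
  | cons a L ih => simp [ih]

theorem listMonomial_add_single [DecidableEq ι] {f : ι → M} (h : ∀ p q, Commute (f p) (f q))
    (l : ι → ℕ) (j : ι) {L : List ι} (hL : L.Nodup) (hj : j ∈ L) :
    listMonomial f (l + Pi.single j 1) L = f j * listMonomial f l L := by
  induction L with
  | nil => simp at hj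
  | cons a L ih =>
    rw [listMonomial_cons, listMonomial_cons]
    rw [List.nodup_cons] at hL
    by_cases haj : a = j
    · subst haj
      have : listMonomial f (l + Pi.single a 1) L = listMonomial f l L :=
        listMonomial_congr fun q hq => by
          have : q ≠ a := fun e => hL.1 (e ▸ hq)
          simp [this]
      rw [this]
      simp [pow_succ', mul_assoc]
    · have hj' : j ∈ L := by simpa [Ne.symm haj] using hj
      rw [ih hL.2 hj']
      have h1 : (l + Pi.single j 1 : ι → ℕ) a = l a := by simp [haj]
      rw [h1, ← mul_assoc, ← mul_assoc, ((h j a).pow_right (l a)).eq]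

theorem listMonomial_single [DecidableEq ι] (f : ι → M) (i : ι) (m : ℕ) {L : List ι}
    (hL : L.Nodup) (hi : i ∈ L) : listMonomial f (Pi.single i m) L = f i ^ m := by
  induction L with
  | nil => simp at hi
  | cons a L ih =>
    rw [List.nodup_cons] at hL
    rw [listMonomial_cons]
    by_cases h : a = i
    · subst h
      rw [listMonomial_congr (g := fun _ => 1) (l' := 0)]
      · simp [listMonomial]
      · intro q hq
        have : q ≠ a := fun e => hL.1 (e ▸ hq)
        simp [this]
    · rw [ih hL.2 (by simpa [Ne.symm h] using hi)]
      simp [h]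

/-- `∏_q f q ^ l q`, in increasing order of `q`. -/
def orderedMonomial {n : ℕ} (f : Fin n → M) (l : Fin n → ℕ) : M :=
  listMonomial f l (List.finRange n)

theorem orderedMonomial_add_single {n : ℕ} {f : Fin n → M} (h : ∀ p q, Commute (f p) (f q))
    (l : Fin n → ℕ) (j : Fin n) :
    orderedMonomial f (l + Pi.single j 1) = f j * orderedMonomial f l :=
  listMonomial_add_single h l j (List.nodup_finRange n) (List.mem_finRange j)

/-! ### Moving one factor through an ordered product under twisted commutation. -/

variable {V : ι → M} {w : ι → ι → M}

theorem mul_pow_of_twist (hV : ∀ i j, V i * V j = V j * V i * w i j)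
    (hVw : ∀ k i j, Commute (V k) (w i j)) (i j : ι) (m : ℕ) :
    V i * V j ^ m = V j ^ m * V i * w i j ^ m := by
  induction m with
  | zero => simp
  | succ m ih =>
    calc V i * V j ^ (m + 1) = V i * V j ^ m * V j := by rw [pow_succ, mul_assoc]
      _ = V j ^ m * V i * (w i j ^ m * V j) := by rw [ih]; simp only [mul_assoc]
      _ = V j ^ m * (V i * V j) * w i j ^ m := by
        rw [← ((hVw j i j).pow_right m).eq]; simp only [mul_assoc]
      _ = _ := by rw [hV i j, pow_succ, pow_succ']; simp only [mul_assoc]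

theorem mul_listMonomial_of_twist (hV : ∀ i j, V i * V j = V j * V i * w i j)
    (hVw : ∀ k i j, Commute (V k) (w i j)) (i : ι) (l : ι → ℕ) (L : List ι) :
    V i * listMonomial V l L = listMonomial V l L * (listMonomial (w i) l L * V i) := by
  induction L with
  | nil => simp
  | cons a L ih =>
    have hc : Commute (listMonomial V l L) (w i a ^ l a) :=
      (Commute.listMonomial_right (fun q => ((hVw q i a).pow_right _).symm) l L).symm
    have hi : Commute (V i) (w i a ^ l a) := (hVw i i a).pow_right _
    rw [listMonomial_cons, listMonomial_cons, ← mul_assoc, mul_pow_of_twist hV hVw]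
    calc V a ^ l a * V i * w i a ^ l a * listMonomial V l L
        = V a ^ l a * (w i a ^ l a * (V i * listMonomial V l L)) := by
          rw [mul_assoc (V a ^ l a), hi.eq]; simp only [mul_assoc]
      _ = V a ^ l a * ((w i a ^ l a * listMonomial V l L) * (listMonomial (w i) l L * V i)) := by
          rw [ih]; simp only [mul_assoc]
      _ = _ := by rw [← hc.eq]; simp only [mul_assoc]

/-- Here the new factor only travels to its own place in the increasing product and merges with the
power already there. It passes just the factors with `q < i`, and only their twists appear. -/
theorem mul_listMonomial_of_twist_of_mem [LinearOrder ι]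
    (hV : ∀ i j, V i * V j = V j * V i * w i j) (hVw : ∀ k i j, Commute (V k) (w i j))
    (i : ι) (l : ι → ℕ) {L : List ι} (hL : L.Pairwise (· < ·)) (hi : i ∈ L) :
    V i * listMonomial V l L =
      listMonomial V (l + Pi.single i 1) L *
        listMonomial (fun q => if q < i then w i q else 1) l L := by
  induction L with
  | nil => simp at hi
  | cons a L ih =>
    rw [List.pairwise_cons] at hL
    by_cases hai : a = i
    · subst hai
      have h1 : listMonomial (fun q => if q < a then w a q else 1) l (a :: L) = 1 := by
        rw [listMonomial_congr (g := fun _ => 1) (l' := l)]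
        · simp [listMonomial]
        · intro q hq
          have : ¬ q < a := by
            rcases List.mem_cons.1 hq with rfl | hq
            · exact lt_irrefl _
            · exact (hL.1 q hq).not_gt
          simp [this]
      have h2 : listMonomial V (l + Pi.single a 1) L = listMonomial V l L :=
        listMonomial_congr fun q hq => by simp [(hL.1 q hq).ne']
      rw [h1, mul_one, listMonomial_cons, listMonomial_cons, h2]
      simp [pow_succ', mul_assoc]
    · have hi' : i ∈ L := by simpa [Ne.symm hai] using hi
      have hlt : a < i := hL.1 i hi'
      have hc : Commute (listMonomial V (l + Pi.single i 1) L) (w i a ^ l a) :=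
        (Commute.listMonomial_right (fun q => ((hVw q i a).pow_right _).symm) _ L).symm
      have hVi : Commute (V i) (w i a ^ l a) := (hVw i i a).pow_right _
      have h1 : (l + Pi.single i 1 : ι → ℕ) a = l a := by simp [hai]
      rw [listMonomial_cons, listMonomial_cons, listMonomial_cons, h1, if_pos hlt, ← mul_assoc,
        mul_pow_of_twist hV hVw]
      calc V a ^ l a * V i * w i a ^ l a * listMonomial V l L
          = V a ^ l a * (w i a ^ l a * (V i * listMonomial V l L)) := by
            rw [mul_assoc (V a ^ l a), hVi.eq]; simp only [mul_assoc]
        _ = _ := by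
            rw [ih hL.2 hi', ← mul_assoc (w i a ^ l a), ← hc.eq]; simp only [mul_assoc]

end Monomial

/-! ### Range projections of powers of an isometry -/

section RangeProj

variable {R : Type*} [Monoid R] [StarMul R]

/-- The projection `v ^ m (v ^ m)^*` onto the range of `v ^ m`. -/
def rangeProj (v : R) (m : ℕ) : R := v ^ m * star v ^ m

variable {v : R}

@[simp] theorem rangeProj_zero (v : R) : rangeProj v 0 = 1 := by simp [rangeProj]

theorem star_rangeProj (v : R) (m : ℕ) : star (rangeProj v m) = rangeProj v m := by
  simp [rangeProj]

theorem rangeProj_mul_of_le (hv : star v * v = 1) {m k : ℕ} (h : m ≤ k) :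
    rangeProj v m * rangeProj v k = rangeProj v k := by
  obtain ⟨d, rfl⟩ := Nat.exists_eq_add_of_le h
  simp only [rangeProj, pow_add v]
  rw [mul_assoc (v ^ m), ← mul_assoc (star v ^ m), ← mul_assoc (star v ^ m),
    pow_mul_pow_eq_one m hv, one_mul, mul_assoc (v ^ m)]

theorem rangeProj_mul_of_ge (hv : star v * v = 1) {m k : ℕ} (h : m ≤ k) :
    rangeProj v k * rangeProj v m = rangeProj v k := by
  have := congrArg star (rangeProj_mul_of_le hv h)
  rwa [star_mul, star_rangeProj, star_rangeProj] at this

theorem rangeProj_succ_mul (hv : star v * v = 1) (m : ℕ) :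
    rangeProj v (m + 1) * v = v * rangeProj v m := by
  rw [rangeProj, rangeProj, mul_assoc, pow_succ (star v), mul_assoc _ (star v), hv, mul_one,
    pow_succ', mul_assoc]

theorem commute_rangeProj_of_commute {x : R} (h : Commute x v) (h' : Commute x (star v)) (m : ℕ) :
    Commute x (rangeProj v m) :=
  (h.pow_right m).mul_right (h'.pow_right m)

/-- Moving `x` through `v ^ m` produces `c ^ m`, moving it through `star v ^ m` produces `d ^ m`,
and these cancel. -/
theorem commute_rangeProj_of_twist {x c d : R} (h : x * v = c * v * x)
    (h' : x * star v = d * star v * x) (hcv : Commute c v) (hdv : Commute d v)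
    (hdv' : Commute d (star v)) (hcd : c * d = 1) (m : ℕ) : Commute x (rangeProj v m) := by
  have h1 : SemiconjBy x v (c * v) := h
  have h2 : SemiconjBy x (star v) (d * star v) := h'
  have h3 := (h1.pow_right m).mul_right (h2.pow_right m)
  have h4 : (c * v) ^ m * (d * star v) ^ m = rangeProj v m := by
    have : Commute (v ^ m) (d ^ m) := (hdv.pow_pow m m).symm
    have hcd' : c ^ m * d ^ m = 1 := pow_mul_pow_eq_one m hcd
    rw [hcv.mul_pow, hdv'.mul_pow, rangeProj, mul_assoc, ← mul_assoc (v ^ m), this.eq,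
      ← mul_assoc, ← mul_assoc, hcd', one_mul]
  rw [h4] at h3
  exact h3

end RangeProj

/-! ### The grading of a Hilbert space by an isometry -/

section Grading

variable {H : Type*} [NormedAddCommGroup H] [InnerProductSpace ℂ H] [CompleteSpace H]

/-- The Wold component of index `k` of an isometry `v`: for finite `k` this is `v ^ k (ker v^*)`,
and for `k = ⊤` it is the intersection of the ranges of all powers of `v`. -/
noncomputable def woldComponent (v : H →L[ℂ] H) (k : ℕ∞) : Submodule ℂ H :=
  ⨅ m : ℕ, LinearMap.ker (rangeProj v m - if (m : ℕ∞) ≤ k then 1 else 0).toLinearMap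

variable {v : H →L[ℂ] H} {k k' : ℕ∞} {x y : H}

/-- The component is a joint eigenspace of the decreasing projections `rangeProj v m`. This treats
finite `k` and `⊤` alike and reduces invariance under an operator to commutation with these
projections. -/
theorem mem_woldComponent :
    x ∈ woldComponent v k ↔ ∀ m : ℕ, rangeProj v m x = if (m : ℕ∞) ≤ k then x else 0 := by
  simp only [woldComponent, Submodule.mem_iInf, LinearMap.mem_ker]
  refine forall_congr' fun m => ?_
  split_ifs <;> simp [sub_eq_zero]

theorem isClosed_woldComponent (v : H →L[ℂ] H) (k : ℕ∞) :
    IsClosed (woldComponent v k : Set H) := by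
  simp only [woldComponent, Submodule.coe_iInf]
  exact isClosed_iInter fun m => ContinuousLinearMap.isClosed_ker _

instance (v : H →L[ℂ] H) (k : ℕ∞) : CompleteSpace (woldComponent v k) :=
  (isClosed_woldComponent v k).completeSpace_coe

theorem apply_mem_woldComponent {T : H →L[ℂ] H} (hT : ∀ m, Commute T (rangeProj v m))
    (hx : x ∈ woldComponent v k) : T x ∈ woldComponent v k := by
  rw [mem_woldComponent] at hx ⊢
  intro m
  have : rangeProj v m (T x) = T (rangeProj v m x) := (DFunLike.congr_fun (hT m).eq x).symm
  rw [this, hx m]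
  split_ifs <;> simp

/-- For `k < k'` the self-adjoint projection of index `k + 1` kills one vector and fixes the other.
-/
theorem inner_eq_zero_of_mem_woldComponent (hk : k ≠ k') (hx : x ∈ woldComponent v k)
    (hy : y ∈ woldComponent v k') : inner ℂ x y = 0 := by
  wlog h : k < k' generalizing k k' x y
  · exact inner_eq_zero_symm.1 (this hk.symm hy hx (hk.lt_or_gt.resolve_left h))
  lift k to ℕ using h.ne_top
  rw [mem_woldComponent] at hx hy
  have hx' := hx (k + 1)
  have hy' := hy (k + 1)
  rw [if_neg (by exact_mod_cast Nat.not_succ_le_self k)] at hx'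
  rw [if_pos (by exact_mod_cast Order.add_one_le_of_lt h)] at hy'
  rw [← hy', ← ContinuousLinearMap.adjoint_inner_left, ← ContinuousLinearMap.star_eq_adjoint,
    star_rangeProj, hx', inner_zero_left]

/-- This follows from `rangeProj v (m + 1) * v = v * rangeProj v m` and the injectivity of `v`. As
`⊤ + 1 = ⊤`, it also covers the unitary part. -/
theorem apply_mem_woldComponent_add_one (hv : star v * v = 1) :
    v x ∈ woldComponent v (k + 1) ↔ x ∈ woldComponent v k := by
  have hinj : Function.Injective v := fun a b h => by
    have := congrArg (⇑(star v)) h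
    rwa [← mul_apply_eq_comp, ← mul_apply_eq_comp, hv] at this
  have h (m : ℕ) : rangeProj v (m + 1) (v x) = v (rangeProj v m x) :=
    DFunLike.congr_fun (rangeProj_succ_mul hv m) x
  have hle (m : ℕ) : ((m + 1 : ℕ) : ℕ∞) ≤ k + 1 ↔ (m : ℕ∞) ≤ k := by
    push_cast
    exact WithTop.add_le_add_iff_right WithTop.one_ne_top
  rw [mem_woldComponent, mem_woldComponent]
  constructor
  · intro hx m
    have := hx (m + 1)
    rw [h] at this
    simp only [hle] at this
    apply hinj
    rw [this]
    split_ifs <;> simp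
  · rintro hx (_ | m)
    · simp
    · rw [h, hx m]
      simp only [hle]
      split_ifs <;> simp

theorem mem_woldComponent_zero (hv : star v * v = 1) :
    x ∈ woldComponent v 0 ↔ star v x = 0 := by
  rw [mem_woldComponent]
  constructor
  · intro h
    have := congrArg (⇑(star v)) (h 1)
    rw [rangeProj, pow_one, pow_one, ← mul_apply_eq_comp, ← mul_assoc, hv, one_mul] at this
    simpa using this
  · rintro h (_ | m)
    · simp
    · rw [rangeProj, pow_succ (star v), mul_apply_eq_comp, mul_apply_eq_comp, h]
      simp

theorem mem_woldComponent_top (hv : star v * v = 1) :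
    x ∈ woldComponent v ⊤ ↔ ∀ m, ∃ y, x = (v ^ m) y := by
  rw [mem_woldComponent]
  simp only [le_top, if_true]
  refine forall_congr' fun m => ⟨fun h => ⟨(star v ^ m) x, by rw [← mul_apply_eq_comp]; exact h.symm⟩,
    ?_⟩
  rintro ⟨y, rfl⟩
  rw [rangeProj, ← mul_apply_eq_comp, mul_assoc, pow_mul_pow_eq_one m hv, mul_one]

theorem exists_eq_apply_of_mem_woldComponent_add_one (hx : x ∈ woldComponent v (k + 1)) :
    x = v (star v x) := by
  have := mem_woldComponent.1 hx 1
  rw [if_pos (by simp)] at this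
  simpa [rangeProj] using this.symm

/-- The Wold decomposition of a single isometry. -/
theorem eq_zero_of_inner_woldComponent (hv : star v * v = 1)
    (h : ∀ k, ∀ y ∈ woldComponent v k, inner ℂ y x = 0) : x = 0 := by
  -- The difference of consecutive range projections is a projection with range inside the component
  -- `m`, so it kills `x`. Hence all range projections fix `x`, which puts `x` in the component `⊤`
  -- and makes it orthogonal to itself.
  have hstep (m : ℕ) : rangeProj v (m + 1) x = rangeProj v m x := by
    set p := rangeProj v m - rangeProj v (m + 1) with hp
    have hpx : p x ∈ woldComponent v m := by
      rw [mem_woldComponent]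
      intro r
      have e : rangeProj v r * p = if (r : ℕ∞) ≤ m then p else 0 := by
        split_ifs with hr
        · have hr : r ≤ m := by exact_mod_cast hr
          rw [hp, mul_sub, rangeProj_mul_of_le hv hr, rangeProj_mul_of_le hv (by omega)]
        · have hr : m + 1 ≤ r := by
            by_contra hlt
            exact hr (by exact_mod_cast (by omega : r ≤ m))
          rw [hp, mul_sub, rangeProj_mul_of_ge hv (by omega), rangeProj_mul_of_ge hv hr, sub_self]
      rw [← mul_apply_eq_comp, e]
      split_ifs <;> simp
    have hpp : p * p = p := by
      rw [hp, mul_sub, sub_mul, sub_mul, rangeProj_mul_of_le hv le_rfl,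
        rangeProj_mul_of_ge hv (Nat.le_succ m), rangeProj_mul_of_le hv (Nat.le_succ m),
        rangeProj_mul_of_le hv le_rfl]
      simp
    have hsp : star p = p := by rw [hp, star_sub, star_rangeProj, star_rangeProj]
    have h0 : p x = 0 := by
      rw [← inner_self_eq_zero (𝕜 := ℂ), ← ContinuousLinearMap.adjoint_inner_left,
        ← ContinuousLinearMap.star_eq_adjoint, hsp, ← mul_apply_eq_comp, hpp]
      exact h m _ hpx
    rw [hp, sub_apply, sub_eq_zero] at h0
    exact h0.symm
  have hall (m : ℕ) : rangeProj v m x = x := by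
    induction m with
    | zero => simp
    | succ m ih => rw [hstep, ih]
  rw [← inner_self_eq_zero (𝕜 := ℂ)]
  exact h ⊤ x (mem_woldComponent.2 fun m => by rw [hall m]; simp)

/-- A subspace invariant under a self-adjoint operator is reducing. -/
theorem starProjection_apply_comm_of_invariant {K : Submodule ℂ H} [K.HasOrthogonalProjection]
    {T : H →L[ℂ] H} (hT : star T = T) (hK : ∀ z ∈ K, T z ∈ K) (x : H) :
    K.starProjection (T x) = T (K.starProjection x) := by
  refine Submodule.eq_starProjection_of_mem_of_inner_eq_zero (hK _ (K.starProjection_apply_mem x))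
    fun w hw => ?_
  rw [← map_sub, ← ContinuousLinearMap.adjoint_inner_right, ← ContinuousLinearMap.star_eq_adjoint,
    hT]
  exact K.starProjection_inner_eq_zero _ _ (hK w hw)

/-! ### Simultaneous Wold decomposition of finitely many isometries. -/

variable {ι : Type*} [Finite ι] {V : ι → H →L[ℂ] H}

/-- The joint Wold decomposition of isometries whose range projections commute. -/
theorem eq_zero_of_inner_iInf_woldComponent (hV : ∀ i, star (V i) * V i = 1)
    (hc : ∀ i j, i ≠ j → ∀ m m', Commute (rangeProj (V i) m) (rangeProj (V j) m'))
    (h : ∀ κ : ι → ℕ∞, ∀ y ∈ ⨅ i, woldComponent (V i) (κ i), inner ℂ y x = 0) : x = 0 := by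
  classical
  have := Fintype.ofFinite ι
  suffices key : ∀ (F : Finset ι) (x : H),
      (∀ κ : ι → ℕ∞, ∀ y ∈ ⨅ i ∈ F, woldComponent (V i) (κ i), inner ℂ y x = 0) → x = 0 from
    key Finset.univ x (by simpa using h)
  intro F
  induction F using Finset.induction with
  | empty =>
    intro x h
    exact inner_self_eq_zero.1 (h 0 x (by simp))
  | insert i F hi ih =>
    intro x h
    refine eq_zero_of_inner_woldComponent (hV i) fun k z hz => ?_
    -- The projection onto a component of `V i` commutes with the range projections of the other
    -- isometries, so it keeps their components invariant. Moved to the other side of the inner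
    -- product, it sends `y` to a vector covered by `h`, and the induction hypothesis applies to the
    -- projected `x`.
    have h0 : (woldComponent (V i) k).starProjection x = 0 := by
      refine ih _ fun κ y hy => ?_
      rw [← Submodule.inner_starProjection_left_eq_right]
      refine h (Function.update κ i k) _ ?_
      simp only [Submodule.mem_iInf] at hy ⊢
      intro j hj
      rcases Finset.mem_insert.1 hj with rfl | hj
      · rw [Function.update_self]
        exact Submodule.starProjection_apply_mem _ _
      · have hji : j ≠ i := fun e => hi (e ▸ hj)
        rw [Function.update_of_ne hji, mem_woldComponent]
        intro m
        rw [← starProjection_apply_comm_of_invariant (star_rangeProj _ _)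
          (fun z hz => apply_mem_woldComponent (fun m' => hc j i hji m m') hz),
          mem_woldComponent.1 (hy j hj) m]
        split_ifs <;> simp
    rw [← Submodule.starProjection_eq_self_iff.2 hz, Submodule.inner_starProjection_left_eq_right,
      h0, inner_zero_right]

end Grading

/-! ### The joint Wold decomposition of a twisted isometry -/

namespace TwistedIsometry

variable {n : ℕ} (S : TwistedIsometry.{u} n)

/-- The twists `U i j`, extended by `1` to the diagonal. -/
noncomputable def twists (i j : Fin n) : S.H →L[ℂ] S.H :=
  if h : i = j then 1 else S.U i j h

@[simp] theorem twists_self (i : Fin n) : S.twists i i = 1 := by simp [twists]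

theorem twists_of_ne {i j : Fin n} (h : i ≠ j) : S.twists i j = S.U i j h := by simp [twists, h]

theorem star_twists (i j : Fin n) : star (S.twists i j) = S.twists j i := by
  by_cases h : i = j
  · subst h; simp
  · rw [S.twists_of_ne h, S.twists_of_ne (Ne.symm h)]
    exact (S.U_swap i j h).symm

theorem commute_twists (i j k l : Fin n) : Commute (S.twists i j) (S.twists k l) := by
  unfold twists
  split_ifs
  · exact Commute.one_left _
  · exact Commute.one_left _
  · exact Commute.one_right _
  · exact S.U_commute _ _ _ _ _ _

theorem V_commute_twists (k i j : Fin n) : Commute (S.V k) (S.twists i j) := by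
  unfold twists
  split_ifs
  · exact Commute.one_right _
  · exact S.V_commute_U _ _ _ _

theorem star_V_commute_twists (k i j : Fin n) : Commute (star (S.V k)) (S.twists i j) := by
  rw [← S.star_twists]
  exact (S.V_commute_twists k j i).star_star

theorem twists_mul_twists (i j : Fin n) : S.twists i j * S.twists j i = 1 := by
  by_cases h : i = j
  · subst h; simp
  · rw [S.twists_of_ne h, S.twists_of_ne (Ne.symm h), S.U_swap i j h]
    exact (Unitary.mem_iff.1 (S.U_unitary i j h)).2

theorem star_V_mul_V {i j : Fin n} (h : i ≠ j) :
    star (S.V i) * S.V j = S.twists j i * (S.V j * star (S.V i)) := by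
  rw [S.twist i j h, ← S.star_twists i j, S.twists_of_ne h, mul_assoc]

/-- The axioms only twist `star (V i)` past `V j`. The products `X = V i * V j` and `Y = U i j * V j
* V i` are isometries with `star X * Y = 1`, so `star (X - Y) * (X - Y) = 1 - 1 - 1 + 1 = 0`. -/
theorem V_mul_V (i j : Fin n) : S.V i * S.V j = S.V j * S.V i * S.twists i j := by
  by_cases hij : i = j
  · subst hij; simp
  rw [((S.V_commute_twists j i j).mul_left (S.V_commute_twists i i j)).eq, ← sub_eq_zero,
    ← CStarRing.star_mul_self_eq_zero_iff]
  have h1 : star (S.V i * S.V j) * (S.V i * S.V j) = 1 := by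
    rw [star_mul, mul_assoc, ← mul_assoc (star (S.V i)), S.isometry, one_mul, S.isometry]
  have h2 : star (S.twists i j * (S.V j * S.V i)) * (S.twists i j * (S.V j * S.V i)) = 1 := by
    rw [star_mul, star_mul, mul_assoc, ← mul_assoc (star (S.twists i j)), S.star_twists,
      S.twists_mul_twists, one_mul, mul_assoc, ← mul_assoc (star (S.V j)), S.isometry, one_mul,
      S.isometry]
  have h3 : star (S.V i * S.V j) * (S.twists i j * (S.V j * S.V i)) = 1 := by
    calc _ = star (S.V j) * (star (S.V i) * S.twists i j) * (S.V j * S.V i) := by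
          rw [star_mul]; simp only [mul_assoc]
      _ = star (S.V j) * S.twists i j * (star (S.V i) * S.V j) * S.V i := by
          rw [(S.star_V_commute_twists i i j).eq]; simp only [mul_assoc]
      _ = star (S.V j) * (S.twists i j * S.twists j i) * (S.V j * (star (S.V i) * S.V i)) := by
          rw [S.star_V_mul_V hij]; simp only [mul_assoc]
      _ = 1 := by rw [S.twists_mul_twists, S.isometry, mul_one, mul_one, S.isometry]
  have h4 := congrArg star h3
  rw [star_mul, star_star, star_one] at h4
  rw [star_sub, sub_mul, mul_sub, mul_sub, h1, h2, h3, h4]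
  simp

/-- Consequently any unitary that intertwines the isometries intertwines the twists. -/
theorem twists_eq {i j : Fin n} (h : i ≠ j) :
    S.twists i j = star (S.V i) * star (S.V j) * S.V i * S.V j := by
  have e : star (S.V j) * S.V i * S.V j = S.V i * S.twists i j := by
    rw [S.star_V_mul_V h.symm, mul_assoc, mul_assoc, S.isometry, mul_one,
      (S.V_commute_twists i i j).eq]
  rw [mul_assoc (star (S.V i)), mul_assoc (star (S.V i)), e, ← mul_assoc, S.isometry, one_mul]

/-- The twists met on passing `V i` and `star (V i)` are inverse to each other. -/
theorem V_commute_rangeProj {i j : Fin n} (h : i ≠ j) (m : ℕ) :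
    Commute (S.V j) (rangeProj (S.V i) m) := by
  refine commute_rangeProj_of_twist (c := S.twists j i) (d := S.twists i j) ?_ ?_
    (S.V_commute_twists _ _ _).symm (S.V_commute_twists _ _ _).symm
    (S.star_V_commute_twists _ _ _).symm (S.twists_mul_twists j i) m
  · rw [S.V_mul_V, ((S.V_commute_twists i j i).mul_left (S.V_commute_twists j j i)).eq, mul_assoc]
  · rw [mul_assoc, S.star_V_mul_V h, ← mul_assoc, S.twists_mul_twists, one_mul]

theorem star_V_commute_rangeProj {i j : Fin n} (h : i ≠ j) (m : ℕ) :
    Commute (star (S.V j)) (rangeProj (S.V i) m) := by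
  rw [← star_rangeProj]
  exact (S.V_commute_rangeProj h m).star_star

theorem twists_commute_rangeProj (i j k : Fin n) (m : ℕ) :
    Commute (S.twists i j) (rangeProj (S.V k) m) :=
  commute_rangeProj_of_commute (S.V_commute_twists _ _ _).symm (S.star_V_commute_twists _ _ _).symm m

theorem rangeProj_commute_rangeProj {i j : Fin n} (h : i ≠ j) (m m' : ℕ) :
    Commute (rangeProj (S.V i) m) (rangeProj (S.V j) m') :=
  commute_rangeProj_of_commute (S.V_commute_rangeProj h m).symm
    (S.star_V_commute_rangeProj h m).symm m'

/-- The component of multi-index `κ` in the joint Wold decomposition. -/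
noncomputable def component (κ : Fin n → ℕ∞) : Submodule ℂ S.H :=
  ⨅ i, woldComponent (S.V i) (κ i)

theorem mem_component {κ : Fin n → ℕ∞} {x : S.H} :
    x ∈ S.component κ ↔ ∀ i, x ∈ woldComponent (S.V i) (κ i) := by
  simp [component, Submodule.mem_iInf]

theorem inner_component_eq_zero {κ κ' : Fin n → ℕ∞} (h : κ ≠ κ') {x y : S.H}
    (hx : x ∈ S.component κ) (hy : y ∈ S.component κ') : inner ℂ x y = 0 := by
  obtain ⟨i, hi⟩ := Function.ne_iff.1 h
  exact inner_eq_zero_of_mem_woldComponent hi (S.mem_component.1 hx i) (S.mem_component.1 hy i)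

theorem eq_zero_of_inner_component {x : S.H}
    (h : ∀ κ, ∀ y ∈ S.component κ, inner ℂ y x = 0) : x = 0 :=
  eq_zero_of_inner_iInf_woldComponent S.isometry (fun _ _ h => S.rangeProj_commute_rangeProj h) h

theorem twists_mem_component (i j : Fin n) {κ : Fin n → ℕ∞} {x : S.H} (hx : x ∈ S.component κ) :
    S.twists i j x ∈ S.component κ := by
  rw [mem_component] at hx ⊢
  exact fun k => apply_mem_woldComponent (S.twists_commute_rangeProj i j k) (hx k)

theorem V_mem_component {i : Fin n} {κ : Fin n → ℕ∞} {x : S.H} (hx : x ∈ S.component κ) :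
    S.V i x ∈ S.component (κ + Pi.single i 1) := by
  rw [mem_component] at hx ⊢
  intro j
  by_cases h : j = i
  · subst h
    rw [Pi.add_apply, Pi.single_eq_same]
    exact (apply_mem_woldComponent_add_one (S.isometry j)).2 (hx j)
  · rw [Pi.add_apply, Pi.single_eq_of_ne h, add_zero]
    exact apply_mem_woldComponent (S.V_commute_rangeProj h) (hx j)

theorem exists_V_eq_of_mem_component {i : Fin n} {κ : Fin n → ℕ∞} {x : S.H}
    (hx : x ∈ S.component (κ + Pi.single i 1)) : ∃ y ∈ S.component κ, S.V i y = x := by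
  rw [mem_component] at hx
  have hi := hx i
  rw [Pi.add_apply, Pi.single_eq_same] at hi
  have e := exists_eq_apply_of_mem_woldComponent_add_one hi
  refine ⟨star (S.V i) x, ?_, e.symm⟩
  rw [mem_component]
  intro j
  by_cases h : j = i
  · subst h
    rw [e] at hi
    exact (apply_mem_woldComponent_add_one (S.isometry j)).1 hi
  · have := hx j
    rw [Pi.add_apply, Pi.single_eq_of_ne h, add_zero] at this
    exact apply_mem_woldComponent (S.star_V_commute_rangeProj h) this

/-- `V i` raises its own index and respects the components of the other isometries; `star (V i)`
supplies preimages. When `κ i = ⊤` the index does not change, so `V i` is onto there. -/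
theorem component_add_single (κ : Fin n → ℕ∞) (i : Fin n) :
    S.component (κ + Pi.single i 1) = (S.component κ).map (S.V i).toLinearMap := by
  ext x
  rw [Submodule.mem_map]
  refine ⟨S.exists_V_eq_of_mem_component, ?_⟩
  rintro ⟨y, hy, rfl⟩
  exact S.V_mem_component hy

theorem component_add_nsmul_single (κ : Fin n → ℕ∞) (i : Fin n) (m : ℕ) :
    S.component (κ + m • Pi.single i 1) = (S.component κ).map (S.V i ^ m).toLinearMap := by
  induction m with
  | zero =>
    rw [zero_smul, add_zero]
    ext x
    simp
  | succ m ih =>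
    rw [succ_nsmul, ← add_assoc, component_add_single, ih, ← Submodule.map_comp, pow_succ']
    rfl

theorem component_add_listSum (κ : Fin n → ℕ∞) (l : Fin n → ℕ) (L : List (Fin n)) :
    S.component (κ + (L.map fun q => l q • (Pi.single q 1 : Fin n → ℕ∞)).sum) =
      (S.component κ).map (listMonomial S.V l L).toLinearMap := by
  induction L with
  | nil =>
    rw [List.map_nil, List.sum_nil, add_zero]
    ext x
    simp
  | cons a L ih =>
    rw [List.map_cons, List.sum_cons, add_comm (l a • _), ← add_assoc, component_add_nsmul_single,
      ih, ← Submodule.map_comp, listMonomial_cons]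
    rfl

theorem component_add (κ : Fin n → ℕ∞) (l : Fin n → ℕ) :
    S.component (κ + fun i => (l i : ℕ∞)) =
      (S.component κ).map (orderedMonomial S.V l).toLinearMap := by
  rw [orderedMonomial, ← component_add_listSum]
  congr 2
  rw [← Fin.sum_univ_def]
  ext i
  simp [Finset.sum_apply, Pi.single_apply]

theorem component_congr_V {κ : Fin n → ℕ∞} {i : Fin n} (hi : κ i = ⊤) :
    (S.component κ).map (S.V i).toLinearMap = S.component κ := by
  rw [← component_add_single]
  congr 1
  ext j
  by_cases h : j = i
  · subst h; simp [hi]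
  · simp [h]

/-- The multi-index that is `0` on `A` and `⊤` off `A`. -/
def wanderingIndex (A : Finset (Fin n)) : Fin n → ℕ∞ := fun i => if i ∈ A then 0 else ⊤

theorem mem_kerSubspace {A : Finset (Fin n)} {x : S.H} :
    x ∈ S.kerSubspace A ↔ ∀ i ∈ A, star (S.V i) x = 0 := by
  simp [kerSubspace, Submodule.mem_iInf]

theorem complMonomial_eq (A : Finset (Fin n)) (l : Fin n → ℕ) :
    S.complMonomial A l = listMonomial S.V l (Aᶜ.sort (· ≤ ·)) := rfl

/-- Taking `l = 0` in the intersection gives the kernel conditions on `A`, and `l = m e_i` puts the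
vector in the range of `V i ^ m`. Conversely the component lies in `kerSubspace A`, and monomials in
the `V q` with `q ∉ A` map it onto itself because `⊤ + l q = ⊤`. -/
theorem wanderingSubspace_eq_component (A : Finset (Fin n)) :
    S.wanderingSubspace A = S.component (wanderingIndex A) := by
  have hsort : ∀ i, i ∈ Aᶜ.sort (· ≤ ·) ↔ i ∉ A := fun i => by simp
  apply le_antisymm
  · intro x hx
    simp only [wanderingSubspace, Submodule.mem_iInf, Submodule.mem_map] at hx
    rw [mem_component]
    intro i
    by_cases hi : i ∈ A
    · rw [wanderingIndex, if_pos hi, mem_woldComponent_zero (S.isometry i)]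
      obtain ⟨y, hy, rfl⟩ := hx 0
      have : S.complMonomial A 0 = 1 := by simp [complMonomial_eq, listMonomial]
      rw [this]
      exact S.mem_kerSubspace.1 hy i hi
    · rw [wanderingIndex, if_neg hi, mem_woldComponent_top (S.isometry i)]
      intro m
      obtain ⟨y, hy, rfl⟩ := hx (Pi.single i m)
      refine ⟨y, ?_⟩
      rw [complMonomial_eq, listMonomial_single S.V i m (Finset.sort_nodup _ _) ((hsort i).2 hi)]
      rfl
  · have hker : S.component (wanderingIndex A) ≤ S.kerSubspace A := by
      intro x hx
      rw [mem_kerSubspace]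
      intro i hi
      have := S.mem_component.1 hx i
      rwa [wanderingIndex, if_pos hi, mem_woldComponent_zero (S.isometry i)] at this
    refine le_iInf fun l => le_trans ?_ (Submodule.map_mono hker)
    rw [complMonomial_eq]
    have : ∀ L : List (Fin n), (∀ i ∈ L, i ∉ A) → (S.component (wanderingIndex A)).map
        (listMonomial S.V l L).toLinearMap = S.component (wanderingIndex A) := by
      intro L hL
      rw [← component_add_listSum]
      congr 1
      induction L with
      | nil => simp
      | cons a L ih =>
        rw [List.map_cons, List.sum_cons, add_comm (l a • _), ← add_assoc,
          ih fun i hi => hL i (List.mem_cons_of_mem _ hi)]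
        have ha : a ∉ A := hL a List.mem_cons_self
        ext i
        by_cases h : i = a
        · subst h; simp [wanderingIndex, ha]
        · simp [h]
    exact (this _ fun i hi => (hsort i).1 hi).ge

end TwistedIsometry

/-! ### The tuple of a twisted noncommutative torus on a wandering subspace -/

theorem ContinuousLinearMap.star_restrict {H : Type*} [NormedAddCommGroup H]
    [InnerProductSpace ℂ H] [CompleteSpace H] {K : Submodule ℂ H} [CompleteSpace K]
    {T : H →L[ℂ] H} (h : ∀ x ∈ K, T x ∈ K) (h' : ∀ x ∈ K, star T x ∈ K) :
    star (T.restrict h) = (star T).restrict h' := by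
  rw [ContinuousLinearMap.star_eq_adjoint]
  symm
  rw [ContinuousLinearMap.eq_adjoint_iff]
  intro x y
  rw [Submodule.coe_inner, Submodule.coe_inner, ContinuousLinearMap.coe_restrict_apply,
    ContinuousLinearMap.coe_restrict_apply, ContinuousLinearMap.star_eq_adjoint,
    ContinuousLinearMap.adjoint_inner_left]

namespace TwistedIsometry

variable {n : ℕ} (S : TwistedIsometry.{u} n)

theorem twists_mem_wanderingSubspace (i j : Fin n) (A : Finset (Fin n)) {x : S.H}
    (hx : x ∈ S.wanderingSubspace A) : S.twists i j x ∈ S.wanderingSubspace A := by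
  rw [wanderingSubspace_eq_component] at hx ⊢
  exact S.twists_mem_component i j hx

theorem map_V_wanderingSubspace {i : Fin n} {A : Finset (Fin n)} (hi : i ∉ A) :
    (S.wanderingSubspace A).map (S.V i).toLinearMap = S.wanderingSubspace A := by
  rw [wanderingSubspace_eq_component]
  exact S.component_congr_V (by simp [wanderingIndex, hi])

theorem V_mem_wanderingSubspace {i : Fin n} {A : Finset (Fin n)} (hi : i ∉ A) {x : S.H}
    (hx : x ∈ S.wanderingSubspace A) : S.V i x ∈ S.wanderingSubspace A := by
  rw [← S.map_V_wanderingSubspace hi]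
  exact Submodule.mem_map_of_mem hx

theorem exists_V_eq_of_mem_wanderingSubspace {i : Fin n} {A : Finset (Fin n)} (hi : i ∉ A)
    {x : S.H} (hx : x ∈ S.wanderingSubspace A) : ∃ y ∈ S.wanderingSubspace A, S.V i y = x := by
  rw [← S.map_V_wanderingSubspace hi] at hx
  exact hx

theorem star_V_apply_V (i : Fin n) (x : S.H) : star (S.V i) (S.V i x) = x := by
  rw [← mul_apply_eq_comp, S.isometry, one_apply_eq_self]

theorem star_V_mem_wanderingSubspace {i : Fin n} {A : Finset (Fin n)} (hi : i ∉ A) {x : S.H}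
    (hx : x ∈ S.wanderingSubspace A) : star (S.V i) x ∈ S.wanderingSubspace A := by
  obtain ⟨y, hy, rfl⟩ := S.exists_V_eq_of_mem_wanderingSubspace hi hx
  rwa [star_V_apply_V]

theorem star_twists_mem_wanderingSubspace (i j : Fin n) (A : Finset (Fin n)) (x : S.H)
    (hx : x ∈ S.wanderingSubspace A) : star (S.twists i j) x ∈ S.wanderingSubspace A := by
  rw [star_twists]
  exact S.twists_mem_wanderingSubspace j i A hx

/-- The restrictions of `V i`, `i ∉ A`, and of the twists to the wandering subspace. -/
noncomputable def torusTuple (A : Finset (Fin n)) :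
    TorusTuple A (S.wanderingSubspace A →L[ℂ] S.wanderingSubspace A) where
  g i hi := (S.V i).restrict fun _ hx => S.V_mem_wanderingSubspace hi hx
  u j k _ := (S.twists j k).restrict fun _ hx => S.twists_mem_wanderingSubspace j k A hx
  g_unitary i hi := by
    rw [Unitary.mem_iff, ContinuousLinearMap.star_restrict _
      fun _ hx => S.star_V_mem_wanderingSubspace hi hx]
    constructor
    · ext x
      exact S.star_V_apply_V i x
    · ext ⟨x, hx⟩
      obtain ⟨y, hy, rfl⟩ := S.exists_V_eq_of_mem_wanderingSubspace hi hx
      exact congrArg (S.V i) (S.star_V_apply_V i y)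
  u_unitary j k h := by
    rw [Unitary.mem_iff, ContinuousLinearMap.star_restrict _
      (S.star_twists_mem_wanderingSubspace j k A)]
    constructor
    · ext x
      change (star (S.twists j k) * S.twists j k) x.1 = x
      rw [star_twists, twists_mul_twists, one_apply_eq_self]
    · ext x
      change (S.twists j k * star (S.twists j k)) x.1 = x
      rw [star_twists, twists_mul_twists, one_apply_eq_self]
  u_swap j k h := by
    rw [ContinuousLinearMap.star_restrict _ (S.star_twists_mem_wanderingSubspace j k A)]
    ext x
    exact (DFunLike.congr_fun (S.star_twists j k) x.1).symm
  g_commute_u i hi j k h := by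
    ext x
    exact DFunLike.congr_fun (S.V_commute_twists i j k).eq x.1
  g_twist i₁ i₂ h₁ h₂ h := by
    ext x
    refine DFunLike.congr_fun (?_ : S.V i₁ * S.V i₂ = S.twists i₁ i₂ * S.V i₂ * S.V i₁) x.1
    rw [S.V_mul_V, mul_assoc (S.twists _ _),
      ((S.V_commute_twists i₂ i₁ i₂).mul_left (S.V_commute_twists i₁ i₁ i₂)).eq]
  u_commute j k h l m h' := by
    ext x
    exact DFunLike.congr_fun (S.commute_twists j k l m).eq x.1

/-- The representation of the twisted noncommutative torus on the wandering subspace. -/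
noncomputable def wanderingRep (A : Finset (Fin n)) :
    TwistedTorus.{u} A →⋆ₐ[ℂ] (S.wanderingSubspace A →L[ℂ] S.wanderingSubspace A) :=
  (TwistedTorus.existsUnique_hom (S.torusTuple A)).choose

theorem wanderingRep_g (A : Finset (Fin n)) (i : Fin n) (hi : i ∉ A) :
    S.wanderingRep A ((TwistedTorus.gen A).g i hi) = (S.torusTuple A).g i hi :=
  (TwistedTorus.existsUnique_hom (S.torusTuple A)).choose_spec.1.1 i hi

theorem wanderingRep_u (A : Finset (Fin n)) (j k : Fin n) (h : j ≠ k) :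
    S.wanderingRep A ((TwistedTorus.gen A).u j k h) = (S.torusTuple A).u j k h :=
  (TwistedTorus.existsUnique_hom (S.torusTuple A)).choose_spec.1.2 j k h

/-- The unital representation of the twisted noncommutative torus attached to `S` and `A`. -/
noncomputable def unitalRep (A : Finset (Fin n)) : UnitalRep.{u} (TwistedTorus.{u} A) where
  H := S.wanderingSubspace A
  π := S.wanderingRep A

end TwistedIsometry

/-! ### Weights -/

namespace TorusTuple

variable {n : ℕ} {A : Finset (Fin n)} {B : Type v} [CStarAlgebra B] (t : TorusTuple A B)

/-- The twists `u i j`, extended by `1` to the diagonal. -/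
noncomputable def twists (i j : Fin n) : B := if h : i = j then 1 else t.u i j h

/-- The unitaries `g i`, extended by `1` to `i ∈ A`. -/
noncomputable def extGen (i : Fin n) : B := if h : i ∈ A then 1 else t.g i h

/-- The factors of the weights. -/
noncomputable def weightFactor (i q : Fin n) : B :=
  if q < i ∨ i ∉ A then t.twists i q else 1

/-- The coefficient with which `V i` moves the vector of multi-index `l` in the model. -/
noncomputable def weight (i : Fin n) (l : Fin n → ℕ) : B :=
  orderedMonomial (t.weightFactor i) l * t.extGen i

@[simp] theorem twists_self (i : Fin n) : t.twists i i = 1 := by simp [twists]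

theorem twists_of_ne {i j : Fin n} (h : i ≠ j) : t.twists i j = t.u i j h := by simp [twists, h]

theorem twists_mem_unitary (i j : Fin n) : t.twists i j ∈ unitary B := by
  unfold twists
  split_ifs
  · exact one_mem _
  · exact t.u_unitary _ _ _

theorem twists_mul_twists (i j : Fin n) : t.twists i j * t.twists j i = 1 := by
  by_cases h : i = j
  · subst h; simp
  · rw [t.twists_of_ne h, t.twists_of_ne (Ne.symm h), t.u_swap i j h]
    exact (Unitary.mem_iff.1 (t.u_unitary i j h)).2

theorem commute_twists (i j k l : Fin n) : Commute (t.twists i j) (t.twists k l) := by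
  unfold twists
  split_ifs
  · exact Commute.one_left _
  · exact Commute.one_left _
  · exact Commute.one_right _
  · exact t.u_commute _ _ _ _ _ _

theorem extGen_commute_twists (i j k : Fin n) : Commute (t.extGen i) (t.twists j k) := by
  unfold twists extGen
  split_ifs
  · exact Commute.one_left _
  · exact Commute.one_left _
  · exact Commute.one_right _
  · exact t.g_commute_u _ _ _ _ _

theorem extGen_mem_unitary (i : Fin n) : t.extGen i ∈ unitary B := by
  unfold extGen
  split_ifs
  · exact one_mem _
  · exact t.g_unitary _ _

theorem commute_weightFactor_of_commute_twists {x : B} (h : ∀ i j, Commute x (t.twists i j))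
    (i q : Fin n) : Commute x (t.weightFactor i q) := by
  unfold weightFactor
  split_ifs
  · exact h _ _
  · exact Commute.one_right _

theorem commute_weightFactor (i j k l : Fin n) :
    Commute (t.weightFactor i j) (t.weightFactor k l) :=
  t.commute_weightFactor_of_commute_twists (fun _ _ =>
    (t.commute_weightFactor_of_commute_twists (t.commute_twists _ _) _ _).symm) _ _

theorem weight_mem_unitary (i : Fin n) (l : Fin n → ℕ) : t.weight i l ∈ unitary B := by
  refine mul_mem (listMonomial_mem (unitary B) (fun q => ?_) _ _) (t.extGen_mem_unitary i)
  unfold weightFactor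
  split_ifs
  · exact t.twists_mem_unitary _ _
  · exact one_mem _

/-- The increment of the multi-index under `V i`. -/
def _root_.shiftIndex (A : Finset (Fin n)) (i : Fin n) : Fin n → ℕ :=
  if i ∈ A then Pi.single i 1 else 0

theorem orderedMonomial_weightFactor_shift (i j : Fin n) (l : Fin n → ℕ) :
    orderedMonomial (t.weightFactor i) (l + shiftIndex A j) =
      (if j ∈ A then t.weightFactor i j else 1) * orderedMonomial (t.weightFactor i) l := by
  unfold shiftIndex
  split_ifs
  · exact orderedMonomial_add_single (fun _ _ => t.commute_weightFactor _ _ _ _) l j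
  · simp

theorem extGen_mul_extGen (i j : Fin n) (hij : i ≠ j) :
    t.extGen i * t.extGen j =
      (if i ∉ A ∧ j ∉ A then t.twists i j else 1) * (t.extGen j * t.extGen i) := by
  by_cases hi : i ∈ A
  · simp [extGen, hi]
  · by_cases hj : j ∈ A
    · simp [extGen, hj]
    · simp [extGen, hi, hj, t.twists_of_ne hij, t.g_twist i j hi hj hij, mul_assoc]

/-- This cocycle identity is what `V_i V_j = U_ij V_j V_i` says on the summand of index `l` of the
model. -/
theorem weight_shift_mul_weight {i j : Fin n} (hij : i ≠ j) (l : Fin n → ℕ) :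
    t.weight i (l + shiftIndex A j) * t.weight j l =
      t.twists i j * (t.weight j (l + shiftIndex A i) * t.weight i l) := by
  have hm : ∀ {x : B} (_ : ∀ i j, Commute x (t.twists i j)) (i : Fin n),
      Commute x (orderedMonomial (t.weightFactor i) l) := fun h i =>
    Commute.listMonomial_right (t.commute_weightFactor_of_commute_twists h i) _ _
  have hmm : Commute (orderedMonomial (t.weightFactor i) l)
      (orderedMonomial (t.weightFactor j) l) :=
    hm (fun _ _ => (hm (t.commute_twists _ _) i).symm) j
  have hg : ∀ i j, Commute (t.extGen i) (orderedMonomial (t.weightFactor j) l) :=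
    fun i => hm (t.extGen_commute_twists i)
  have expand : ∀ i j : Fin n, t.weight i (l + shiftIndex A j) * t.weight j l =
      (if j ∈ A then t.weightFactor i j else 1) *
        (orderedMonomial (t.weightFactor i) l * orderedMonomial (t.weightFactor j) l) *
        (t.extGen i * t.extGen j) := by
    intro i j
    rw [weight, weight, orderedMonomial_weightFactor_shift, mul_assoc, ← mul_assoc (t.extGen i),
      (hg i j).eq]
    simp only [mul_assoc]
  have hc : Commute (if i ∉ A ∧ j ∉ A then t.twists i j else 1)
      (orderedMonomial (t.weightFactor i) l * orderedMonomial (t.weightFactor j) l) := by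
    split_ifs
    · exact (hm (t.commute_twists _ _) i).mul_right (hm (t.commute_twists _ _) j)
    · exact Commute.one_left _
  -- After the common monomials are removed, only the factors created by the two shifts and by
  -- exchanging the generators remain. In each case either `t.twists i j` stands on both sides, or
  -- the right side is `t.twists i j * t.twists j i = 1`.
  have hcoeff : (if j ∈ A then t.weightFactor i j else 1) *
      (if i ∉ A ∧ j ∉ A then t.twists i j else 1) =
      t.twists i j * (if i ∈ A then t.weightFactor j i else 1) := by
    have h1 := t.twists_mul_twists i j
    by_cases hi : i ∈ A <;> by_cases hj : j ∈ A
    · rcases hij.lt_or_gt with h | h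
      · simp [hi, hj, weightFactor, h, h.not_gt, h1]
      · simp [hi, hj, weightFactor, h, h.not_gt]
    · simp [hi, hj, weightFactor, h1]
    · simp [hi, hj, weightFactor]
    · simp [hi, hj]
  rw [expand i j, expand j i, t.extGen_mul_extGen i j hij, ← hmm.eq]
  generalize orderedMonomial (t.weightFactor i) l * orderedMonomial (t.weightFactor j) l = M at hc ⊢
  generalize t.extGen j * t.extGen i = G
  rw [← mul_assoc, mul_assoc _ M, ← hc.eq, ← mul_assoc, hcoeff]
  simp only [mul_assoc]

variable {C : Type*} [CStarAlgebra C]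

theorem map_weight (φ : B →⋆ₐ[ℂ] C) {t : TorusTuple A B} {t' : TorusTuple A C}
    (hg : ∀ i h, φ (t.g i h) = t'.g i h) (hu : ∀ j k h, φ (t.u j k h) = t'.u j k h)
    (i : Fin n) (l : Fin n → ℕ) : φ (t.weight i l) = t'.weight i l := by
  have h1 : ∀ i j, φ (t.twists i j) = t'.twists i j := by
    intro i j
    unfold twists
    split_ifs <;> simp [hu]
  have h2 : ∀ i, φ (t.extGen i) = t'.extGen i := by
    intro i
    unfold extGen
    split_ifs <;> simp [hg]
  have h3 : ∀ i j, φ (t.weightFactor i j) = t'.weightFactor i j := by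
    intro i j
    unfold weightFactor
    split_ifs <;> simp [h1]
  rw [weight, weight, map_mul, h2, orderedMonomial, orderedMonomial, map_listMonomial]
  simp only [h3]

end TorusTuple

/-! ### Hilbert sums -/

section HilbertSum

variable {ι : Type*} {G : ι → Type*} [∀ i, NormedAddCommGroup (G i)]
  [∀ i, InnerProductSpace ℂ (G i)] {E : Type*} [NormedAddCommGroup E] [InnerProductSpace ℂ E]
  [CompleteSpace E] {W : ∀ i, G i →ₗᵢ[ℂ] E}

theorem IsHilbertSum.continuousLinearMap_ext (hW : IsHilbertSum ℂ G W) {F : Type*}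
    [NormedAddCommGroup F] [NormedSpace ℂ F] {f g : E →L[ℂ] F}
    (h : ∀ i x, f (W i x) = g (W i x)) : f = g := by
  ext y
  have hy := hW.hasSum_linearIsometryEquiv_symm (hW.linearIsometryEquiv y)
  rw [LinearIsometryEquiv.symm_apply_apply] at hy
  refine (hy.mapL f).unique ?_
  simp only [h]
  exact hy.mapL g

theorem IsHilbertSum.exists_equiv (hW : IsHilbertSum ℂ G W) {E' : Type*} [NormedAddCommGroup E']
    [InnerProductSpace ℂ E'] [CompleteSpace E'] {W' : ∀ i, G i →ₗᵢ[ℂ] E'}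
    (hW' : IsHilbertSum ℂ G W') : ∃ Ψ : E ≃ₗᵢ[ℂ] E', ∀ i x, Ψ (W i x) = W' i x := by
  classical
  refine ⟨hW.linearIsometryEquiv.trans hW'.linearIsometryEquiv.symm, fun i x => ?_⟩
  rw [LinearIsometryEquiv.trans_apply, ← hW.linearIsometryEquiv_symm_apply_single x,
    LinearIsometryEquiv.apply_symm_apply, hW'.linearIsometryEquiv_symm_apply_single]

end HilbertSum

/-- Multi-indices supported in `A`. -/
@[ext]
structure MultiIndex {n : ℕ} (A : Finset (Fin n)) : Type where
  val : Fin n → ℕ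
  eq_zero : ∀ i ∉ A, val i = 0

namespace MultiIndex

variable {n : ℕ} {A : Finset (Fin n)}

/-- The action of the `i`-th shift on multi-indices. -/
def shift (i : Fin n) (l : MultiIndex A) : MultiIndex A :=
  ⟨l.1 + shiftIndex A i, fun j hj => by
    unfold shiftIndex
    split_ifs with hi
    · have : j ≠ i := fun e => hj (e ▸ hi)
      simp [l.2 j hj, this]
    · simp [l.2 j hj]⟩

@[simp] theorem shift_val (i : Fin n) (l : MultiIndex A) :
    (shift i l).1 = l.1 + shiftIndex A i := rfl

theorem shift_injective (i : Fin n) : Function.Injective (shift (A := A) i) := fun _ _ h =>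
  MultiIndex.ext (add_right_cancel (congrArg val h))

instance : Zero (MultiIndex A) := ⟨⟨0, fun _ _ => rfl⟩⟩

@[simp] theorem zero_val : (0 : MultiIndex A).1 = 0 := rfl

instance : Countable (MultiIndex A) := 
  Function.Injective.countable (f := val) fun _ _ h => MultiIndex.ext h

theorem shift_of_notMem {i : Fin n} (hi : i ∉ A) (l : MultiIndex A) : shift i l = l :=
  MultiIndex.ext (by simp [shiftIndex, hi])

theorem shift_comm (i j : Fin n) (l : MultiIndex A) : shift i (shift j l) = shift j (shift i l) :=
  MultiIndex.ext (by simp [add_right_comm])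

theorem exists_shift_eq {i : Fin n} {l : MultiIndex A} (h : i ∈ A → l.1 i ≠ 0) :
    ∃ l', shift i l' = l := by
  by_cases hi : i ∈ A
  · refine ⟨⟨l.1 - Pi.single i 1, fun j hj => by simp [l.2 j hj]⟩, MultiIndex.ext ?_⟩
    ext j
    by_cases hj : j = i
    · subst hj
      have := h hi
      simp [shiftIndex, hi]
      omega
    · simp [shiftIndex, hi, hj]
  · exact ⟨l, shift_of_notMem hi l⟩

/-- The index in the joint Wold decomposition that corresponds to a multi-index. -/
def woldIndex (l : MultiIndex A) : Fin n → ℕ∞ :=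
  TwistedIsometry.wanderingIndex A + fun i => (l.1 i : ℕ∞)

theorem woldIndex_apply (l : MultiIndex A) (i : Fin n) :
    woldIndex l i = if i ∈ A then (l.1 i : ℕ∞) else ⊤ := by
  unfold woldIndex TwistedIsometry.wanderingIndex
  by_cases hi : i ∈ A <;> simp [hi]

theorem woldIndex_zero : woldIndex (0 : MultiIndex A) = TwistedIsometry.wanderingIndex A := by
  ext i
  simp [woldIndex]

/-- `A` is recovered as the set of finite coordinates. -/
theorem woldIndex_injective :
    Function.Injective fun p : (A : Finset (Fin n)) × MultiIndex A => woldIndex p.2 := by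
  rintro ⟨A, l⟩ ⟨B, m⟩ h
  have h' : ∀ i, (if i ∈ A then (l.1 i : ℕ∞) else ⊤) = if i ∈ B then (m.1 i : ℕ∞) else ⊤ :=
    fun i => by rw [← woldIndex_apply, ← woldIndex_apply]; exact congrFun h i
  have hAB : A = B := by
    ext i
    have := h' i
    by_cases hA : i ∈ A <;> by_cases hB : i ∈ B <;> simp_all
  subst hAB
  congr 1
  refine MultiIndex.ext (funext fun i => ?_)
  by_cases hi : i ∈ A
  · simpa [hi] using h' i
  · rw [l.2 i hi, m.2 i hi]

theorem exists_woldIndex_eq (κ : Fin n → ℕ∞) :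
    ∃ p : (A : Finset (Fin n)) × MultiIndex A, woldIndex p.2 = κ := by
  classical
  -- The default value `ENat.toNat ⊤ = 0` makes the multi-index vanish off `A`.
  refine ⟨⟨Finset.univ.filter fun i => κ i ≠ ⊤, ⟨fun i => (κ i).toNat, fun i hi => ?_⟩⟩, ?_⟩
  · have : κ i = ⊤ := by simpa using hi
    simp [this]
  · ext i
    rw [woldIndex_apply]
    by_cases h : κ i = ⊤
    · simp [h]
    · simp [h, ENat.natCast_toNat]

end MultiIndex

/-! ### The space as a Hilbert sum of translates of wandering subspaces. -/

namespace TwistedIsometry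

variable {n : ℕ} (S : TwistedIsometry.{u} n)

theorem coe_listMonomial_apply {ι H : Type*} [NormedAddCommGroup H] [InnerProductSpace ℂ H]
    {K : Submodule ℂ H} {f : ι → K →L[ℂ] K} {F : ι → H →L[ℂ] H}
    (h : ∀ q y, (f q y : H) = F q y) (l : ι → ℕ) (L : List ι) (x : K) :
    (listMonomial f l L x : H) = listMonomial F l L x := by
  have hpow : ∀ q m (y : K), ((f q ^ m) y : H) = (F q ^ m) y := by
    intro q m
    induction m with
    | zero => simp
    | succ m ih => intro y; rw [pow_succ, pow_succ, mul_apply_eq_comp, mul_apply_eq_comp, ih, h]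
  induction L with
  | nil => simp
  | cons a L ih =>
    rw [listMonomial_cons, listMonomial_cons, mul_apply_eq_comp, mul_apply_eq_comp, hpow, ih]

theorem torusTuple_twists_apply (A : Finset (Fin n)) (i j : Fin n) (x : S.wanderingSubspace A) :
    ((S.torusTuple A).twists i j x : S.H) = S.twists i j x := by
  by_cases h : i = j
  · subst h; simp
  · rw [TorusTuple.twists_of_ne _ h]; rfl

/-- This explains the weights. For `i ∈ A` the factor `V i` is absorbed at its place in the product,
leaving the twists with `q < i`; for `i ∉ A` it passes the whole product, leaving all twists, and
acts on `x` itself. -/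
theorem V_orderedMonomial (A : Finset (Fin n)) (l : Fin n → ℕ) (i : Fin n)
    (x : S.wanderingSubspace A) :
    S.V i (orderedMonomial S.V l x) =
      orderedMonomial S.V (l + shiftIndex A i) ((S.torusTuple A).weight i l x : S.H) := by
  have hw : ((S.torusTuple A).weight i l x : S.H) =
      orderedMonomial (fun q => if q < i ∨ i ∉ A then S.twists i q else 1) l
        ((if i ∈ A then 1 else S.V i : S.H →L[ℂ] S.H) x) := by
    rw [TorusTuple.weight, mul_apply_eq_comp, orderedMonomial,
      coe_listMonomial_apply (F := fun q => if q < i ∨ i ∉ A then S.twists i q else 1)]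
    · congr 1
      unfold TorusTuple.extGen
      split_ifs <;> rfl
    · intro q y
      unfold TorusTuple.weightFactor
      split_ifs
      · exact S.torusTuple_twists_apply A i q y
      · rfl
  rw [hw, ← mul_apply_eq_comp, ← mul_apply_eq_comp, ← mul_apply_eq_comp]
  congr 1
  by_cases hi : i ∈ A
  · simp only [hi, shiftIndex, not_true_eq_false, or_false, if_true, mul_one]
    exact mul_listMonomial_of_twist_of_mem S.V_mul_V S.V_commute_twists i l
      (List.pairwise_lt_finRange n) (List.mem_finRange i)
  · simp only [hi, shiftIndex, not_false_eq_true, or_true, if_true, if_false, add_zero]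
    exact mul_listMonomial_of_twist S.V_mul_V S.V_commute_twists i l _

theorem norm_listMonomial (l : Fin n → ℕ) (L : List (Fin n)) (x : S.H) :
    ‖listMonomial S.V l L x‖ = ‖x‖ := by
  have hpow : ∀ q m (y : S.H), ‖(S.V q ^ m) y‖ = ‖y‖ := by
    intro q m
    induction m with
    | zero => simp
    | succ m ih => intro y; rw [pow_succ, mul_apply_eq_comp, ih, S.norm_V]
  induction L with
  | nil => simp
  | cons a L ih => rw [listMonomial_cons, mul_apply_eq_comp, hpow, ih]

/-- The isometric embedding `x ↦ V^l x` of a wandering subspace. -/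
noncomputable def embed (A : Finset (Fin n)) (l : Fin n → ℕ) :
    S.wanderingSubspace A →ₗᵢ[ℂ] S.H where
  toLinearMap := (orderedMonomial S.V l).toLinearMap.comp (S.wanderingSubspace A).subtype
  norm_map' x := S.norm_listMonomial l _ x

theorem embed_apply (A : Finset (Fin n)) (l : Fin n → ℕ) (x : S.wanderingSubspace A) :
    S.embed A l x = orderedMonomial S.V l (x : S.H) := rfl

theorem V_embed (A : Finset (Fin n)) (l : Fin n → ℕ) (i : Fin n) (x : S.wanderingSubspace A) :
    S.V i (S.embed A l x) = S.embed A (l + shiftIndex A i) ((S.torusTuple A).weight i l x) :=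
  S.V_orderedMonomial A l i x

theorem component_woldIndex {A : Finset (Fin n)} (l : MultiIndex A) :
    S.component l.woldIndex = LinearMap.range (S.embed A l.1).toLinearMap := by
  rw [MultiIndex.woldIndex, component_add, ← wanderingSubspace_eq_component]
  ext x
  simp [embed_apply]

/-- The pairs `(A, l)` correspond bijectively to the indices `κ`, so this is the joint Wold
decomposition with each component written as a translate. -/
theorem isHilbertSum_embed :
    IsHilbertSum ℂ (fun p : (A : Finset (Fin n)) × MultiIndex A => S.wanderingSubspace p.1)
      fun p => S.embed p.1 p.2.1 := by
  have hmem : ∀ (p : (A : Finset (Fin n)) × MultiIndex A) (x : S.wanderingSubspace p.1),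
      S.embed p.1 p.2.1 x ∈ S.component p.2.woldIndex := fun p x => by
    rw [component_woldIndex]
    exact LinearMap.mem_range_self _ _
  refine IsHilbertSum.mk ?_ ?_
  · intro p p' h x y
    exact S.inner_component_eq_zero (MultiIndex.woldIndex_injective.ne h) (hmem p x) (hmem p' y)
  · rw [top_le_iff, Submodule.topologicalClosure_eq_top_iff, Submodule.eq_bot_iff]
    intro y hy
    refine S.eq_zero_of_inner_component fun κ z hz => ?_
    obtain ⟨p, rfl⟩ := MultiIndex.exists_woldIndex_eq κ
    rw [component_woldIndex] at hz
    exact (Submodule.mem_orthogonal _ _).1 hy z (Submodule.mem_iSup_of_mem p hz)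

/-- Both spaces are Hilbert sums of the same family, through `S.embed` and through `T.embed` after
`Ψ`. Matching summands gives the unitary; it intertwines the isometries because `Ψ` intertwines the
weights, which are words in the tuple. -/
theorem equiv_of_torusTuple {S T : TwistedIsometry.{u} n}
    (Ψ : ∀ A, S.wanderingSubspace A ≃ₗᵢ[ℂ] T.wanderingSubspace A)
    (hg : ∀ A i h, (Ψ A).conjStarAlgEquiv ((S.torusTuple A).g i h) = (T.torusTuple A).g i h)
    (hu : ∀ A j k h, (Ψ A).conjStarAlgEquiv ((S.torusTuple A).u j k h) = (T.torusTuple A).u j k h) :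
    S ≈ T := by
  have hT : IsHilbertSum ℂ
      (fun p : (A : Finset (Fin n)) × MultiIndex A => S.wanderingSubspace p.1)
      fun p => (T.embed p.1 p.2.1).comp (Ψ p.1).toLinearIsometry := by
    have h := T.isHilbertSum_embed
    refine IsHilbertSum.mk (fun p p' hp x y => h.OrthogonalFamily hp _ _) ?_
    have := h.surjective_isometry
    rw [← LinearIsometry.coe_toLinearMap, ← LinearMap.range_eq_top,
      h.OrthogonalFamily.range_linearIsometry] at this
    refine this.ge.trans (Submodule.topologicalClosure_mono (iSup_mono fun p => ?_))
    rintro _ ⟨x, rfl⟩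
    exact ⟨(Ψ p.1).symm x, by simp⟩
  have hweight : ∀ A i l (x : S.wanderingSubspace A),
      Ψ A ((S.torusTuple A).weight i l x) = (T.torusTuple A).weight i l (Ψ A x) := by
    intro A i l x
    have := TorusTuple.map_weight ((Ψ A).conjStarAlgEquiv.toStarAlgHom)
      (hg A) (hu A) i l
    rw [← this]
    exact congrArg (Ψ A) (by simp)
  obtain ⟨Φ, hΦ⟩ := S.isHilbertSum_embed.exists_equiv hT
  refine ⟨Φ, fun i x => ?_⟩
  have key : (Φ.toContinuousLinearEquiv : S.H →L[ℂ] T.H) ∘L S.V i =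
      T.V i ∘L (Φ.toContinuousLinearEquiv : S.H →L[ℂ] T.H) := by
    refine S.isHilbertSum_embed.continuousLinearMap_ext fun p x => ?_
    change Φ (S.V i (S.embed p.1 p.2.1 x)) = T.V i (Φ (S.embed p.1 p.2.1 x))
    have h1 := hΦ ⟨p.1, p.2.shift i⟩ ((S.torusTuple p.1).weight i p.2.1 x)
    have h2 := hΦ p x
    rw [V_embed, h2]
    refine h1.trans ?_
    change T.embed p.1 _ (Ψ p.1 _) = T.V i (T.embed p.1 _ (Ψ p.1 x))
    rw [V_embed, hweight]
    rfl
  exact DFunLike.congr_fun key x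

end TwistedIsometry

/-! ### The model of a family of tuples -/

theorem lp_separableSpace {ι : Type*} [Countable ι] {G : ι → Type*}
    [∀ i, NormedAddCommGroup (G i)] [∀ i, InnerProductSpace ℂ (G i)]
    [∀ i, TopologicalSpace.SeparableSpace (G i)] : TopologicalSpace.SeparableSpace (lp G 2) := by
  classical
  rw [← TopologicalSpace.isSeparable_univ_iff]
  have h1 : TopologicalSpace.IsSeparable
      (⋃ i, Set.range fun x : G i => (lp.single 2 i x : lp G 2)) :=
    TopologicalSpace.IsSeparable.iUnion fun i =>
      TopologicalSpace.isSeparable_range (lp.isometry_single i).continuous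
  refine (h1.span (R := ℂ)).closure.mono fun f _ => ?_
  refine mem_closure_of_tendsto (lp.hasSum_single (by simp) f) (Filter.Eventually.of_forall fun s => ?_)
  exact Submodule.sum_mem _ fun i _ => Submodule.subset_span (Set.mem_iUnion.2 ⟨i, f i, rfl⟩)

namespace TorusModelSpace

variable {n : ℕ} (K : Finset (Fin n) → Type u) [∀ A, NormedAddCommGroup (K A)]
  [∀ A, InnerProductSpace ℂ (K A)]

/-- The Hilbert space of the model: `⨁_A ℓ²(ℕ^A) ⊗ K A`. -/
abbrev Space : Type u :=
  lp (fun p : (A : Finset (Fin n)) × MultiIndex A => K p.1) 2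

variable {K}

open Classical in
/-- The embedding of `K A` into the summand of multi-index `l`. -/
noncomputable def emb (A : Finset (Fin n)) (l : MultiIndex A) : K A →ₗᵢ[ℂ] Space K where
  toFun x := lp.single (E := fun p : (A : Finset (Fin n)) × MultiIndex A => K p.1) 2 ⟨A, l⟩ x
  map_add' x y := by simp
  map_smul' c x := by simp
  norm_map' x := lp.norm_single (by simp) _ _

theorem inner_emb_left (A : Finset (Fin n)) (l : MultiIndex A) (x : K A) (f : Space K) :
    inner ℂ (emb A l x) f = inner ℂ x (f ⟨A, l⟩) := by
  classical
  exact lp.inner_single_left (𝕜 := ℂ)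
    (G := fun p : (A : Finset (Fin n)) × MultiIndex A => K p.1) ⟨A, l⟩ x f

theorem eq_emb_of_forall_ne {A : Finset (Fin n)} {l : MultiIndex A} {f : Space K}
    (h : ∀ p : (A : Finset (Fin n)) × MultiIndex A, p ≠ ⟨A, l⟩ → f p = 0) :
    f = emb A l (f ⟨A, l⟩) := by
  classical
  refine lp.ext (funext fun p => ?_)
  by_cases hp : p = ⟨A, l⟩
  · subst hp
    exact (lp.single_apply_self
      (E := fun p : (A : Finset (Fin n)) × MultiIndex A => K p.1) 2 ⟨A, l⟩ (f ⟨A, l⟩)).symm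
  · rw [h p hp]
    exact (lp.single_apply_ne
      (E := fun p : (A : Finset (Fin n)) × MultiIndex A => K p.1) 2 ⟨A, l⟩ (f ⟨A, l⟩) hp).symm

variable [∀ A, CompleteSpace (K A)]

theorem isHilbertSum_emb :
    IsHilbertSum ℂ (fun p : (A : Finset (Fin n)) × MultiIndex A => K p.1)
      fun p => emb (K := K) p.1 p.2 := by
  classical
  have h : OrthogonalFamily ℂ (fun p : (A : Finset (Fin n)) × MultiIndex A => K p.1)
      fun p => emb (K := K) p.1 p.2 := by
    intro p q hpq x y
    rw [inner_emb_left]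
    have : (emb (K := K) q.1 q.2 y) p = 0 := lp.single_apply_ne _ _ _ hpq
    rw [this, inner_zero_right]
  refine ⟨h, fun f => ⟨f, ?_⟩⟩
  rw [h.linearIsometry_apply]
  exact (lp.hasSum_single (by simp) f).tsum_eq

/-- A unitary operator as a linear isometry. -/
noncomputable def _root_.ContinuousLinearMap.toIsometryOfUnitary {H : Type*}
    [NormedAddCommGroup H] [InnerProductSpace ℂ H] [CompleteSpace H] (T : H →L[ℂ] H)
    (hT : T ∈ unitary (H →L[ℂ] H)) : H →ₗᵢ[ℂ] H where
  toLinearMap := T.toLinearMap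
  norm_map' x := ContinuousLinearMap.norm_map_iff_adjoint_comp_self T |>.2
    (Unitary.mem_iff.1 hT).1 x

/-! ### The weighted shifts of the model and their relations. -/

variable (t : ∀ A : Finset (Fin n), TorusTuple A (K A →L[ℂ] K A))

theorem sigmaShift_injective (i : Fin n) :
    Function.Injective fun p : (A : Finset (Fin n)) × MultiIndex A =>
      (⟨p.1, p.2.shift i⟩ : (A : Finset (Fin n)) × MultiIndex A) := by
  rintro ⟨A, l⟩ ⟨B, m⟩ h
  obtain ⟨h₁, h₂⟩ := Sigma.mk.inj_iff.1 h
  dsimp only at h₁ h₂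
  subst h₁
  rw [MultiIndex.shift_injective i (eq_of_heq h₂)]

/-- The shift of indices is injective and the weights are unitary, so the shifted summands stay
orthogonal and the assembled operator is an isometry. -/
theorem orthogonalFamily_shift (i : Fin n) :
    OrthogonalFamily ℂ (fun p : (A : Finset (Fin n)) × MultiIndex A => K p.1) fun p =>
      (emb (K := K) p.1 (p.2.shift i)).comp (((t p.1).weight i p.2.1).toIsometryOfUnitary
        ((t p.1).weight_mem_unitary i p.2.1)) :=
  fun _ _ hpq _ _ => isHilbertSum_emb.OrthogonalFamily ((sigmaShift_injective i).ne hpq) _ _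

theorem orthogonalFamily_twists (j k : Fin n) :
    OrthogonalFamily ℂ (fun p : (A : Finset (Fin n)) × MultiIndex A => K p.1) fun p =>
      (emb (K := K) p.1 p.2).comp (((t p.1).twists j k).toIsometryOfUnitary
        ((t p.1).twists_mem_unitary j k)) :=
  fun _ _ hpq _ _ => isHilbertSum_emb.OrthogonalFamily hpq _ _

/-- The `i`-th isometry of the model. -/
noncomputable def V (i : Fin n) : Space K →L[ℂ] Space K :=
  (orthogonalFamily_shift t i).linearIsometry.toContinuousLinearMap

/-- The twists of the model. -/
noncomputable def U (j k : Fin n) : Space K →L[ℂ] Space K :=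
  (orthogonalFamily_twists t j k).linearIsometry.toContinuousLinearMap

theorem V_emb (i : Fin n) (A : Finset (Fin n)) (l : MultiIndex A) (x : K A) :
    V t i (emb A l x) = emb A (l.shift i) ((t A).weight i l.1 x) := by
  classical
  exact (orthogonalFamily_shift t i).linearIsometry_apply_single
    (i := (⟨A, l⟩ : (A : Finset (Fin n)) × MultiIndex A)) x

theorem U_emb (j k : Fin n) (A : Finset (Fin n)) (l : MultiIndex A) (x : K A) :
    U t j k (emb A l x) = emb A l ((t A).twists j k x) := by
  classical
  exact (orthogonalFamily_twists t j k).linearIsometry_apply_single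
    (i := (⟨A, l⟩ : (A : Finset (Fin n)) × MultiIndex A)) x

theorem star_V_mul_V (i : Fin n) : star (V t i) * V t i = 1 :=
  (ContinuousLinearMap.norm_map_iff_adjoint_comp_self _).1 fun x =>
    LinearIsometry.norm_map _ x

theorem ext_emb {f g : Space K →L[ℂ] Space K} (h : ∀ A l x, f (emb A l x) = g (emb A l x)) :
    f = g :=
  isHilbertSum_emb.continuousLinearMap_ext fun p x => h p.1 p.2 x

theorem U_mul_U (j k : Fin n) : U t j k * U t k j = 1 := by
  refine ext_emb fun A l x => ?_
  rw [mul_apply_eq_comp, U_emb, U_emb, ← mul_apply_eq_comp, (t A).twists_mul_twists]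
  rfl

theorem star_U_mul_U (j k : Fin n) : star (U t j k) * U t j k = 1 :=
  (ContinuousLinearMap.norm_map_iff_adjoint_comp_self _).1 fun x =>
    LinearIsometry.norm_map _ x

theorem star_U (j k : Fin n) : star (U t j k) = U t k j :=
  left_inv_eq_right_inv (star_U_mul_U t j k) (U_mul_U t j k)

theorem U_commute_U (i j k l : Fin n) : Commute (U t i j) (U t k l) := by
  refine ext_emb fun A m x => ?_
  rw [mul_apply_eq_comp, mul_apply_eq_comp, U_emb, U_emb, U_emb, U_emb, ← mul_apply_eq_comp,
    ← mul_apply_eq_comp, ((t A).commute_twists i j k l).eq]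

theorem _root_.TorusTuple.commute_weight_twists {A : Finset (Fin n)} {B : Type*} [CStarAlgebra B]
    (t : TorusTuple A B) (i j k : Fin n) (l : Fin n → ℕ) :
    Commute (t.weight i l) (t.twists j k) :=
  Commute.mul_left (Commute.listMonomial_right
    (t.commute_weightFactor_of_commute_twists (t.commute_twists j k) i) l _).symm
    (t.extGen_commute_twists i j k)

theorem V_commute_U (i j k : Fin n) : Commute (V t i) (U t j k) := by
  refine ext_emb fun A m x => ?_
  rw [mul_apply_eq_comp, mul_apply_eq_comp, U_emb, V_emb, V_emb, U_emb, ← mul_apply_eq_comp,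
    ← mul_apply_eq_comp, ((t A).commute_weight_twists i j k m.1).eq]

theorem V_mul_V {i j : Fin n} (h : i ≠ j) : V t i * V t j = U t i j * (V t j * V t i) := by
  refine ext_emb fun A l x => ?_
  rw [mul_apply_eq_comp, mul_apply_eq_comp, mul_apply_eq_comp, V_emb, V_emb, V_emb, V_emb, U_emb,
    MultiIndex.shift_comm, ← mul_apply_eq_comp, ← mul_apply_eq_comp, ← mul_apply_eq_comp]
  have := (t A).weight_shift_mul_weight h l.1
  rw [MultiIndex.shift_val, MultiIndex.shift_val, this]
  rfl

theorem emb_shift (i : Fin n) (A : Finset (Fin n)) (l : MultiIndex A) (x : K A) :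
    emb A (l.shift i) x = V t i (emb A l (star ((t A).weight i l.1) x)) := by
  rw [V_emb, ← mul_apply_eq_comp, (Unitary.mem_iff.1 ((t A).weight_mem_unitary i l.1)).2]
  rfl

/-- Within the summands belonging to `A`, the range of `V t i` only involves indices with positive
`i`-th coordinate, so this vector is orthogonal to the range. -/
theorem star_V_emb_eq_zero {i : Fin n} {A : Finset (Fin n)} (hi : i ∈ A) {l : MultiIndex A}
    (hl : l.1 i = 0) (x : K A) : star (V t i) (emb A l x) = 0 := by
  have key : ∀ z, inner ℂ (emb A l x) (V t i z) = 0 := by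
    intro z
    have : (innerSL ℂ (emb A l x)) ∘L V t i = 0 := by
      refine isHilbertSum_emb.continuousLinearMap_ext fun p y => ?_
      change inner ℂ (emb A l x) (V t i (emb p.1 p.2 y)) = 0
      rw [V_emb]
      refine isHilbertSum_emb.OrthogonalFamily (i := ⟨A, l⟩) (j := ⟨p.1, p.2.shift i⟩) ?_ x _
      rintro h
      obtain ⟨rfl, h⟩ := Sigma.mk.inj_iff.1 h
      rw [eq_of_heq h] at hl
      simp [shiftIndex, hi] at hl
    exact DFunLike.congr_fun this z
  rw [← inner_self_eq_zero (𝕜 := ℂ)]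
  rw [ContinuousLinearMap.star_eq_adjoint, ContinuousLinearMap.adjoint_inner_left]
  exact key _

theorem twist {i j : Fin n} (h : i ≠ j) :
    star (V t i) * V t j = star (U t i j) * V t j * star (V t i) := by
  refine ext_emb fun A l x => ?_
  rw [mul_apply_eq_comp, mul_apply_eq_comp]
  -- In the first case both sides vanish, since `V t j` leaves the `i`-th coordinate at `0`.
  -- Otherwise the vector has the form `V t i y`, and `V_j V_i = U_ji V_i V_j` gives the claim after
  -- cancelling `star (V t i) * V t i`.
  by_cases hl : i ∈ A ∧ l.1 i = 0
  · rw [star_V_emb_eq_zero t hl.1 hl.2, map_zero, V_emb, star_V_emb_eq_zero t hl.1]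
    unfold MultiIndex.shift shiftIndex
    split_ifs <;> simp [hl.2, h]
  · obtain ⟨l, rfl⟩ := MultiIndex.exists_shift_eq (i := i) (l := l) fun hi h0 => hl ⟨hi, h0⟩
    rw [emb_shift t]
    generalize (emb A l _ : Space K) = y
    rw [← mul_apply_eq_comp (star (V t i)) (V t i), star_V_mul_V, one_apply_eq_self,
      ← mul_apply_eq_comp (V t j), V_mul_V t h.symm, mul_apply_eq_comp, mul_apply_eq_comp,
      ← star_U t i j]
    have hc : Commute (star (V t i)) (star (U t i j)) := (V_commute_U t i i j).star_star
    rw [← mul_apply_eq_comp (star (V t i)), hc.eq, mul_apply_eq_comp,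
      ← mul_apply_eq_comp (star (V t i)), star_V_mul_V]
    rfl

variable [∀ A, TopologicalSpace.SeparableSpace (K A)]

/-- The model twisted isometry of a family of tuples. -/
noncomputable def twistedIsometry : TwistedIsometry.{u} n where
  H := Space K
  separableSpace := lp_separableSpace
  V := V t
  U i j _ := U t i j
  isometry := star_V_mul_V t
  U_unitary i j _ := Unitary.mem_iff.2 ⟨star_U_mul_U t i j, by rw [star_U, U_mul_U]⟩
  U_swap i j _ := (star_U t i j).symm
  U_commute _ _ _ _ _ _ := U_commute_U t _ _ _ _
  twist _ _ h := twist t h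
  V_commute_U _ _ _ _ := V_commute_U t _ _ _

/-- For `i ∈ A`, the index starts at `0` in the kernel of `star (V t i)` and grows by one with each
shift. For `i ∉ A`, `V t i` acts on the summand by a unitary weight. -/
theorem emb_mem_component (A : Finset (Fin n)) (l : MultiIndex A) (x : K A) :
    emb A l x ∈ (twistedIsometry t).component l.woldIndex := by
  refine (TwistedIsometry.mem_component _).2 fun i => ?_
  rw [MultiIndex.woldIndex_apply]
  split_ifs with hi
  · generalize hk : l.1 i = k
    induction k generalizing l x with
    | zero =>
      exact (mem_woldComponent_zero (star_V_mul_V t i)).2 (star_V_emb_eq_zero t hi hk x)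
    | succ k ih =>
      obtain ⟨l, rfl⟩ := MultiIndex.exists_shift_eq (i := i) (l := l) fun _ => by omega
      rw [emb_shift t, Nat.cast_succ]
      refine (apply_mem_woldComponent_add_one (star_V_mul_V t i)).2 (ih _ _ ?_)
      simpa [shiftIndex, hi] using hk
  · refine (mem_woldComponent_top (star_V_mul_V t i)).2 fun m => ?_
    -- Keeping the preimage in the same summand lets the induction go on.
    have : ∃ y : K A, emb A l x = (V t i ^ m) (emb A l y) := by
      induction m with
      | zero => exact ⟨x, rfl⟩
      | succ m ih =>
        obtain ⟨y, hy⟩ := ih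
        refine ⟨star ((t A).weight i l.1) y, ?_⟩
        rw [pow_succ, mul_apply_eq_comp, ← emb_shift t, MultiIndex.shift_of_notMem hi, hy]
    exact ⟨_, this.choose_spec⟩

/-- All other summands lie in other joint components, so a vector of the wandering subspace is
orthogonal to them and lives at `(A, 0)`. -/
theorem wanderingSubspace_eq (A : Finset (Fin n)) :
    (twistedIsometry t).wanderingSubspace A = LinearMap.range (emb (K := K) A 0).toLinearMap := by
  rw [TwistedIsometry.wanderingSubspace_eq_component, ← MultiIndex.woldIndex_zero]
  refine le_antisymm (fun f hf => ?_) ?_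
  · refine ⟨_, (eq_emb_of_forall_ne (A := A) (l := 0) fun p hp => ?_).symm⟩
    refine inner_self_eq_zero (𝕜 := ℂ).1 ((inner_emb_left p.1 p.2 _ _).symm.trans ?_)
    exact (twistedIsometry t).inner_component_eq_zero (MultiIndex.woldIndex_injective.ne hp)
      (emb_mem_component t _ _ _) hf
  · rintro _ ⟨x, rfl⟩
    exact emb_mem_component t A 0 x

/-- The wandering subspaces of the model are the given Hilbert spaces. -/
noncomputable def wanderingEquiv (A : Finset (Fin n)) :
    K A ≃ₗᵢ[ℂ] (twistedIsometry t).wanderingSubspace A :=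
  (emb (K := K) A 0).equivRange.trans
    (LinearIsometryEquiv.ofEq _ _ (wanderingSubspace_eq t A).symm)

/-- At index `0` no twists have accumulated, so the model restricts to the given generators there.
-/
theorem _root_.TorusTuple.weight_zero {A : Finset (Fin n)} {B : Type*} [CStarAlgebra B]
    (t : TorusTuple A B) {i : Fin n} (hi : i ∉ A) : t.weight i 0 = t.g i hi := by
  simp [TorusTuple.weight, orderedMonomial, listMonomial, TorusTuple.extGen, hi]

theorem wanderingEquiv_g (A : Finset (Fin n)) (i : Fin n) (hi : i ∉ A) (x : K A) :
    wanderingEquiv t A ((t A).g i hi x) =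
      ((twistedIsometry t).torusTuple A).g i hi (wanderingEquiv t A x) := by
  apply Subtype.ext
  change emb A 0 _ = V t i (emb A 0 x)
  rw [V_emb, MultiIndex.shift_of_notMem hi, MultiIndex.zero_val, (t A).weight_zero hi]

theorem wanderingEquiv_u (A : Finset (Fin n)) (j k : Fin n) (h : j ≠ k) (x : K A) :
    wanderingEquiv t A ((t A).u j k h x) =
      ((twistedIsometry t).torusTuple A).u j k h (wanderingEquiv t A x) := by
  apply Subtype.ext
  change emb A 0 _ = (twistedIsometry t).twists j k (emb A 0 x)
  rw [TwistedIsometry.twists_of_ne _ h]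
  change _ = U t j k (emb A 0 x)
  rw [U_emb, (t A).twists_of_ne h]

end TorusModelSpace

/-! ### The classification -/

/-- The image of the generators of the twisted noncommutative torus under a representation. -/
noncomputable def UnitalRep.tuple {n : ℕ} {A : Finset (Fin n)}
    (ρ : UnitalRep.{u} (TwistedTorus.{u} A)) : TorusTuple A (ρ.H →L[ℂ] ρ.H) where
  g i h := ρ.π ((TwistedTorus.gen A).g i h)
  u j k h := ρ.π ((TwistedTorus.gen A).u j k h)
  g_unitary i h := Unitary.map_mem ρ.π ((TwistedTorus.gen A).g_unitary i h)
  u_unitary j k h := Unitary.map_mem ρ.π ((TwistedTorus.gen A).u_unitary j k h)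
  u_swap j k h := by rw [(TwistedTorus.gen A).u_swap j k h, map_star]
  g_commute_u i hi j k h := ((TwistedTorus.gen A).g_commute_u i hi j k h).map ρ.π
  g_twist i₁ i₂ h₁ h₂ h := by
    rw [← map_mul, (TwistedTorus.gen A).g_twist i₁ i₂ h₁ h₂ h, map_mul, map_mul]
  u_commute j k h l m h' := ((TwistedTorus.gen A).u_commute j k h l m h').map ρ.π

/-- Representations of the twisted noncommutative torus are equivalent as soon as the images of the
generators are. -/
theorem UnitalRep.equiv_of_tuple {n : ℕ} {A : Finset (Fin n)}
    {ρ τ : UnitalRep.{u} (TwistedTorus.{u} A)} (Ψ : ρ.H ≃ₗᵢ[ℂ] τ.H)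
    (hg : ∀ i h x, Ψ (ρ.tuple.g i h x) = τ.tuple.g i h (Ψ x))
    (hu : ∀ j k h x, Ψ (ρ.tuple.u j k h x) = τ.tuple.u j k h (Ψ x)) : ρ ≈ τ := by
  -- Conjugation by `Ψ` turns `ρ` into a representation that agrees with `τ` on the generators,
  -- hence everywhere.
  have key : Ψ.conjStarAlgEquiv.toStarAlgHom.comp ρ.π = τ.π := by
    refine TwistedTorus.hom_ext (fun i h => ?_) (fun j k h => ?_)
    · ext y
      exact (hg i h (Ψ.symm y)).trans (by rw [Ψ.apply_symm_apply]; rfl)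
    · ext y
      exact (hu j k h (Ψ.symm y)).trans (by rw [Ψ.apply_symm_apply]; rfl)
  refine ⟨Ψ, fun a x => ?_⟩
  rw [← key]
  exact congrArg (fun z => Ψ (ρ.π a z)) (Ψ.symm_apply_apply x).symm

/-! ### Invariance under unitary equivalence and the bijection on classes. -/

namespace TwistedIsometry

variable {n : ℕ}

theorem unitalRep_tuple (S : TwistedIsometry.{u} n) (A : Finset (Fin n)) :
    (∀ i h, (S.unitalRep A).tuple.g i h = (S.torusTuple A).g i h) ∧
      ∀ j k h, (S.unitalRep A).tuple.u j k h = (S.torusTuple A).u j k h :=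
  ⟨S.wanderingRep_g A, S.wanderingRep_u A⟩

theorem equiv_star_V {S T : TwistedIsometry.{u} n} {Ψ : S.H ≃ₗᵢ[ℂ] T.H}
    (h : ∀ i x, Ψ (S.V i x) = T.V i (Ψ x)) (i : Fin n) (x : S.H) :
    Ψ (star (S.V i) x) = star (T.V i) (Ψ x) := by
  have h1 : Ψ.conjStarAlgEquiv (S.V i) = T.V i := by
    ext y
    exact (h i _).trans (congrArg (T.V i) (Ψ.apply_symm_apply y))
  rw [← h1, ← map_star, LinearIsometryEquiv.conjStarAlgEquiv_apply_apply, Ψ.symm_apply_apply]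

theorem equiv_twists {S T : TwistedIsometry.{u} n} {Ψ : S.H ≃ₗᵢ[ℂ] T.H}
    (h : ∀ i x, Ψ (S.V i x) = T.V i (Ψ x)) {i j : Fin n} (hij : i ≠ j) (x : S.H) :
    Ψ (S.twists i j x) = T.twists i j (Ψ x) := by
  rw [S.twists_eq hij, T.twists_eq hij]
  simp only [mul_apply_eq_comp, equiv_star_V h, h]

theorem equiv_mem_wanderingSubspace {S T : TwistedIsometry.{u} n} {Ψ : S.H ≃ₗᵢ[ℂ] T.H}
    (h : ∀ i x, Ψ (S.V i x) = T.V i (Ψ x)) {A : Finset (Fin n)} {x : S.H}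
    (hx : x ∈ S.wanderingSubspace A) : Ψ x ∈ T.wanderingSubspace A := by
  have hpow : ∀ i m x, Ψ ((S.V i ^ m) x) = (T.V i ^ m) (Ψ x) := by
    intro i m
    induction m with
    | zero => simp
    | succ m ih => intro x; rw [pow_succ, pow_succ, mul_apply_eq_comp, mul_apply_eq_comp, ih, h]
  have hmono : ∀ (l : Fin n → ℕ) L x,
      Ψ (listMonomial S.V l L x) = listMonomial T.V l L (Ψ x) := by
    intro l L
    induction L with
    | nil => simp
    | cons a L ih =>
      intro x
      rw [listMonomial_cons, listMonomial_cons, mul_apply_eq_comp, mul_apply_eq_comp, hpow, ih]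
  simp only [wanderingSubspace, Submodule.mem_iInf, Submodule.mem_map] at hx ⊢
  intro l
  obtain ⟨y, hy, rfl⟩ := hx l
  refine ⟨Ψ y, ?_, (hmono l _ y).symm⟩
  rw [mem_kerSubspace] at hy ⊢
  intro i hi
  rw [← equiv_star_V h, hy i hi, map_zero]

theorem equiv_symm {S T : TwistedIsometry.{u} n} {Ψ : S.H ≃ₗᵢ[ℂ] T.H}
    (h : ∀ i x, Ψ (S.V i x) = T.V i (Ψ x)) (i : Fin n) (x : T.H) :
    Ψ.symm (T.V i x) = S.V i (Ψ.symm x) :=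
  Ψ.injective (by simp [h])

/-- Unitary equivalence of twisted isometries restricts to the wandering subspaces. -/
theorem unitalRep_equiv {S T : TwistedIsometry.{u} n} (hST : S ≈ T) (A : Finset (Fin n)) :
    S.unitalRep A ≈ T.unitalRep A := by
  obtain ⟨Ψ, h⟩ := hST
  let Ψ' : S.wanderingSubspace A ≃ₗᵢ[ℂ] T.wanderingSubspace A :=
    { toFun := fun x => ⟨Ψ x, equiv_mem_wanderingSubspace h x.2⟩
      invFun := fun y => ⟨Ψ.symm y, equiv_mem_wanderingSubspace (equiv_symm h) y.2⟩
      left_inv := fun x => Subtype.ext (Ψ.symm_apply_apply _)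
      right_inv := fun y => Subtype.ext (Ψ.apply_symm_apply _)
      map_add' := fun x y => Subtype.ext (map_add Ψ _ _)
      map_smul' := fun c x => Subtype.ext (map_smul Ψ _ _)
      norm_map' := fun x => Ψ.norm_map x }
  refine UnitalRep.equiv_of_tuple Ψ' (fun i hi x => ?_) (fun j k hjk x => ?_)
  · rw [(S.unitalRep_tuple A).1, (T.unitalRep_tuple A).1]
    exact Subtype.ext (h i _)
  · rw [(S.unitalRep_tuple A).2, (T.unitalRep_tuple A).2]
    exact Subtype.ext (equiv_twists h hjk _)

theorem equiv_of_unitalRep {S T : TwistedIsometry.{u} n}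
    (h : ∀ A, S.unitalRep A ≈ T.unitalRep A) : S ≈ T := by
  choose Ψ hΨ using h
  refine equiv_of_torusTuple Ψ (fun A i hi => ?_) (fun A j k hjk => ?_)
  · ext y
    have := (hΨ A ((TwistedTorus.gen A).g i hi) ((Ψ A).symm y)).trans
      (congrArg _ ((Ψ A).apply_symm_apply y))
    rw [← wanderingRep_g, ← wanderingRep_g]
    exact congrArg Subtype.val this
  · ext y
    have := (hΨ A ((TwistedTorus.gen A).u j k hjk) ((Ψ A).symm y)).trans
      (congrArg _ ((Ψ A).apply_symm_apply y))
    rw [← wanderingRep_u, ← wanderingRep_u]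
    exact congrArg Subtype.val this

/-- The model built from the images of the generators has the prescribed tuples on its wandering
subspaces. -/
theorem exists_unitalRep_equiv
    (ρ : ∀ A : Finset (Fin n), UnitalRep.{u} (TwistedTorus.{u} A)) :
    ∃ S : TwistedIsometry.{u} n, ∀ A, S.unitalRep A ≈ ρ A := by
  let t : ∀ A, TorusTuple A ((ρ A).H →L[ℂ] (ρ A).H) := fun A => (ρ A).tuple
  refine ⟨TorusModelSpace.twistedIsometry t, fun A => Setoid.symm ?_⟩
  refine UnitalRep.equiv_of_tuple (τ := (TorusModelSpace.twistedIsometry t).unitalRep A)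
    (TorusModelSpace.wanderingEquiv t A) (fun i hi x => ?_) (fun j k hjk x => ?_)
  · rw [(unitalRep_tuple _ A).1]
    exact TorusModelSpace.wanderingEquiv_g t A i hi x
  · rw [(unitalRep_tuple _ A).2]
    exact TorusModelSpace.wanderingEquiv_u t A j k hjk x

/-- The classes of the representations on the wandering subspaces. -/
noncomputable def classification (n : ℕ) (s : Quotient (TwistedIsometry.setoid.{u} n)) :
    ∀ A : Finset (Fin n), Quotient (UnitalRep.setoid.{u} (TwistedTorus.{u} A)) :=
  Quotient.lift (fun S A => Quotient.mk _ (S.unitalRep A))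
    (fun _ _ h => funext fun A => Quotient.sound (unitalRep_equiv h A)) s

theorem classification_bijective (n : ℕ) : Function.Bijective (classification.{u} n) := by
  constructor
  · intro s t
    refine Quotient.inductionOn₂ s t fun S T h => ?_
    exact Quotient.sound (equiv_of_unitalRep fun A => Quotient.exact (congrFun h A))
  · intro q
    obtain ⟨S, hS⟩ := exists_unitalRep_equiv fun A => (q A).out
    refine ⟨Quotient.mk _ S, funext fun A => ?_⟩
    exact (Quotient.sound (hS A)).trans (Quotient.out_eq (q A))

end TwistedIsometry

theorem theorem7p1 (n : ℕ) (hn : 1 < n) :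
    ∃ Φ : Quotient (TwistedIsometry.setoid.{u} n) ≃
        (∀ A : Finset (Fin n), Quotient (UnitalRep.setoid.{u} (TwistedTorus.{u} A))),
      ∀ (S : TwistedIsometry.{u} n) (A : Finset (Fin n)),
        ∃ π : TwistedTorus.{u} A →⋆ₐ[ℂ] (S.wanderingSubspace A →L[ℂ] S.wanderingSubspace A),
          (∀ (i : Fin n) (hi : i ∉ A) (x : S.wanderingSubspace A),
            (π ((TwistedTorus.gen A).g i hi) x : S.H) = S.V i x) ∧
          (∀ (j k : Fin n) (h : j ≠ k) (x : S.wanderingSubspace A),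
            (π ((TwistedTorus.gen A).u j k h) x : S.H) = S.U j k h x) ∧
          Φ (Quotient.mk _ S) A =
            Quotient.mk _
              ({ H := S.wanderingSubspace A, π := π } : UnitalRep.{u} (TwistedTorus.{u} A)) := by
  refine ⟨Equiv.ofBijective _ (TwistedIsometry.classification_bijective n), fun S A =>
    ⟨S.wanderingRep A, fun i hi x => ?_, fun j k h x => ?_, rfl⟩⟩
  · rw [S.wanderingRep_g]
    rfl
  · rw [S.wanderingRep_u, ← S.twists_of_ne h]
    rfl
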